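/- For $n\ge 0$ let $H_n(x)=(-1)^n e^{x^2}\frac{d^n}{dx^n}e^{-x^2}$ be the Hermite polynomials, $\gamma_n=2^n n!\sqrt{\pi}$, and let $\psi_n(x)=e^{-x^2/2}H_n(x)/\sqrt{\gamma_n}$ be the Hermite functions. Let $\Pi_n^{\mathrm F}$ be the orthogonal projection of $L^2(\mathbb R)$ onto $\mathrm{span}\{\psi_0,\dots,\psi_n\}$. For $\rho>0$ let $\mathcal S_\rho=\{z\in\mathbb C:\ -\rho\le \mathrm{Im}\, z\le\rho\}$. Let $\rho>0$, $\sigma\in\mathbb R$, $M\in\mathbb R$, and let $f$ be analytic in (a neighbourhood of each point of) $\mathcal S_\rho$ such that $|e^{z^2/2}f(z)|\le M|z|^\sigma$ for all $z\in\mathcal S_\rho$ with $|z|$ sufficiently large. Then $f$ is integrable along both lines of $\partial\mathcal S_\rho$ and square integrable on $\mathbb R$, and with $$\widehat V=\int_{\partial\mathcal S_\rho}|f(z)|\,|dz|=\int_{\mathbb R}|f(x+i\rho)|\,dx+\int_{\mathbb R}|f(x-i\rho)|\,dx,\qquad c_k=\int_{\mathbb R}f(x)\psi_k(x)\,dx,$$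 one has $\Pi_n^{\mathrm F}f=\sum_{k=0}^n c_k\psi_k$ for all $n\ge0$, and the following hold. (i) There are real numbers $K_n$ with $K_n\to \widehat V/(2^{3/4}\sqrt{\pi})$ as $n\to\infty$ such that, for every $n\ge\max\{\lfloor\sigma\rfloor,0\}$, $$|c_n|\le K_n\,\frac{e^{-\rho\sqrt{2(n+1)}}}{(n+1)^{1/4}}.$$ (ii) There are real numbers $K_n$ with $K_n\to \widehat V/\sqrt{4\pi\rho}$ as $n\to\infty$ such that, for every $n\ge0$, $$\|f-\Pi_n^{\mathrm F}f\|_{L^2(\mathbb R)}\le K_n\,e^{-\rho\sqrt{2n}}.$$ (iii) There are real numbers $K_n$ with $K_n\to \widehat V/(2^{1/4}\pi^{3/4}\rho)$ as $n\to\infty$ such that, for every $n\ge1$, $$\|f-\Pi_n^{\mathrm F}f\|_{L^\infty(\mathbb R)}\le K_n\,n^{1/4}e^{-\rho\sqrt{2n}}.$$ -/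

import Mathlib

open MeasureTheory

noncomputable section

namespace HermiteApprox

/-- The Hermite weight `ω(x) = exp (-x ^ 2)`. -/
def weight (x : ℝ) : ℝ := Real.exp (-x ^ 2)

/-- The (physicists') Hermite polynomial `H_n`, given by the Rodrigues formula
`H_n(x) = ((-1) ^ n / ω(x)) * ω⁽ⁿ⁾(x)`. -/
def hermiteH (n : ℕ) (x : ℝ) : ℝ :=
  (-1) ^ n / weight x * iteratedDeriv n weight x

/-- The squared norm `γ_n = 2 ^ n n! √π` of `H_n` in the weighted `L²` space. -/
def gammaNorm (n : ℕ) : ℝ := 2 ^ n * (n.factorial : ℝ) * Real.sqrt Real.pi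

/-- The Hermite function `ψ_n(x) = exp (-x ^ 2 / 2) H_n(x) / √γ_n`. -/
def hermitePsi (n : ℕ) (x : ℝ) : ℝ :=
  Real.exp (-x ^ 2 / 2) * hermiteH n x / Real.sqrt (gammaNorm n)

theorem exists_hermiteH_eq (n : ℕ) : ∃ p : Polynomial ℝ, ∀ x, hermiteH n x = p.eval x := by
  have key : ∃ p : Polynomial ℝ, ∀ x, iteratedDeriv n weight x = p.eval x * weight x := by
    induction n with
    | zero => exact ⟨1, fun x => by simp⟩
    | succ n ih =>
      obtain ⟨p, hp⟩ := ih
      refine ⟨Polynomial.derivative p - Polynomial.C 2 * Polynomial.X * p, fun x => ?_⟩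
      have hfun : iteratedDeriv n weight = fun y => p.eval y * weight y := funext hp
      have hw : HasDerivAt weight (-(2 * x) * weight x) x := by
        have h1 : HasDerivAt (fun y : ℝ => -y ^ 2) (-(2 * x)) x := by
          have h0 := (hasDerivAt_pow 2 x).fun_neg
          simpa using h0
        have h2 := h1.exp
        rw [mul_comm] at h2
        exact h2
      rw [iteratedDeriv_succ, hfun, ((p.hasDerivAt x).fun_mul hw).deriv]
      simp only [Polynomial.eval_sub, Polynomial.eval_mul, Polynomial.eval_C, Polynomial.eval_X]
      ring
  obtain ⟨p, hp⟩ := key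
  refine ⟨Polynomial.C ((-1) ^ n) * p, fun x => ?_⟩
  have hne : weight x ≠ 0 := (Real.exp_pos _).ne'
  rw [hermiteH, hp x, Polynomial.eval_mul, Polynomial.eval_C]
  field_simp

theorem integrable_poly_mul_gaussian (p : Polynomial ℝ) :
    Integrable (fun x : ℝ => p.eval x * Real.exp (-x ^ 2)) := by
  induction p using Polynomial.induction_on' with
  | add p q hp hq =>
    refine (hp.add hq).congr (Filter.Eventually.of_forall fun x => ?_)
    simp [add_mul]
  | monomial k a =>
    have h := (integrable_rpow_mul_exp_neg_mul_sq (b := 1) one_pos (s := (k : ℝ))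
      (by have : (0 : ℝ) ≤ k := k.cast_nonneg
          linarith)).const_mul a
    simpa [Real.rpow_natCast, mul_assoc] using h

theorem memLp_hermitePsi (n : ℕ) : MemLp (fun x : ℝ => (hermitePsi n x : ℂ)) 2 volume := by
  obtain ⟨p, hp⟩ := exists_hermiteH_eq n
  have hcont : Continuous (hermitePsi n) := by
    have : hermitePsi n = fun x => Real.exp (-x ^ 2 / 2) * p.eval x / Real.sqrt (gammaNorm n) := by
      funext x
      rw [hermitePsi, hp x]
    rw [this]
    have := p.continuous
    fun_prop
  suffices h2 : MemLp (hermitePsi n) 2 volume from h2.ofReal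
  rw [memLp_two_iff_integrable_sq hcont.aestronglyMeasurable]
  have h := (integrable_poly_mul_gaussian (p ^ 2)).div_const (Real.sqrt (gammaNorm n) ^ 2)
  refine h.congr (Filter.Eventually.of_forall fun x => ?_)
  have he : Real.exp (-x ^ 2) = Real.exp (-x ^ 2 / 2) ^ 2 := by
    rw [← Real.exp_nat_mul]
    congr 1
    push_cast
    ring
  simp only [hermitePsi, hp x, Polynomial.eval_pow, he]
  ring

/-- The space `ℍ_n = span {ψ_0, …, ψ_n}`, as a subspace of `L²(ℝ)`. -/
def hermiteSpace (n : ℕ) : Submodule ℂ (Lp ℂ 2 (volume : Measure ℝ)) :=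
  Submodule.span ℂ (Set.range fun k : Fin (n + 1) => (memLp_hermitePsi k).toLp _)

instance (n : ℕ) : FiniteDimensional ℂ (hermiteSpace n) :=
  FiniteDimensional.span_of_finite ℂ (Set.finite_range _)

/-- The orthogonal projection `Π_n^F` of `L²(ℝ)` onto `ℍ_n`. -/
def hermiteProj (n : ℕ) :
    Lp ℂ 2 (volume : Measure ℝ) →L[ℂ] Lp ℂ 2 (volume : Measure ℝ) :=
  (hermiteSpace n).starProjection

/-- The coefficient `c_n = ∫ g(x) ψ_n(x) dx`. -/
def hermiteCoeff (g : ℝ → ℂ) (n : ℕ) : ℂ := ∫ x : ℝ, g x * (hermitePsi n x : ℂ)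

/-- The closed infinite strip `S_ρ = {z | Im z ∈ [-ρ, ρ]}`. -/
def strip (ρ : ℝ) : Set ℂ := {z | z.im ∈ Set.Icc (-ρ) ρ}

/-- `∫ |f(z)| |dz|` over the boundary of `S_ρ`, that is over the two lines `Im z = ρ` and
`Im z = -ρ`. -/
def boundaryIntegral (f : ℂ → ℂ) (ρ : ℝ) : ℝ :=
  (∫ x : ℝ, ‖f (x + ρ * Complex.I)‖) + ∫ x : ℝ, ‖f (x - ρ * Complex.I)‖

end HermiteApprox

end

/-!
Write `F(z) = exp (z ^ 2 / 2) f(z)`, which grows polynomially in the strip. By the Rodrigues formula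
`c_n` is, up to a factor, the integral of `F` against the `n`-th derivative of `exp (-x ^ 2)`.
Cauchy's formula on the strip `|Im s| ≤ η` writes this derivative as a difference of the integrals
of `exp (-s ^ 2) / (s - x) ^ (n + 1)` over the lines `Im s = ± η`
(`iteratedDeriv_weight_eq_lineKernel`). In the term with pole line `Im s = -η` the `x`-integral is
moved up to `Im z = ρ`, in the other one down to `Im z = -ρ`: both times away from the pole, whose
distance becomes `η + ρ` (`norm_hermiteCoeff_le`). With the saddle point
`η = √((n + 1) / 2) - ρ / 2` the prefactor is `exp (-ρ √(2 (n + 1))) (n + 1) ^ (-1 / 4)` times a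
constant given by Stirling's formula. The normalised kernel
`(1 + w ^ 2 / (η + ρ) ^ 2) ^ (-(n + 1) / 2)` tends to `exp (-w ^ 2)`, so by dominated convergence
the remaining double integral tends to a Gaussian convolution, and the boundary integral of `‖f‖`
appears with its sharp constant (`exists_coeff_bound`). For the finitely many small `n` any bound
will do, because only the limit of `K_n` is prescribed (`exists_tendsto_of_eventually_le`).

The Hermite functions are orthonormal and complete, so the squared `L²` error is the tail
`∑_{k > n} |c_k| ^ 2`, and the square of the coefficient rate is dominated by a telescoping
difference of `exp (-2 ρ √(2 k)) / (√2 ρ)` (`coeffRate_sq_le`, `exists_l2_bound`).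

For the uniform error, Bessel's inequality is applied to the generating function
`∑ H_n(x) w ^ n / n! = exp (2 x w - w ^ 2)` on a circle: the sum of `ψ_k(x) ^ 2`, weighted by a
Poisson distribution with mean `m ^ 2`, is at most a constant times the average of
`exp (-(x - √2 m cos θ) ^ 2)` over `θ`, which tends to zero uniformly in `x`
(`sum_poisson_mul_hermitePsi_sq_le`, `exists_integral_phase_le`). The Poisson weights are of order
`1 / m` on the block `m ^ 2 ≤ k ≤ m ^ 2 + 2 m`, so there `∑ ψ_k(x) ^ 2 = o(m)`
(`exists_sum_block_le`). By Cauchy–Schwarz on each block and the exponential decay from block to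
block, the tail is `o(n ^ (1 / 4) exp (-ρ √(2 n)))` (`sum_coeff_mul_psi_le`). This is stronger than
the required bound, so a sequence `K_n` with the stated limit exists (`exists_linfty_bound`).
-/

noncomputable section

namespace HermiteApprox

open Filter Topology

section Hermite

open Polynomial

/-! ### Hermite polynomials -/

/-- The physicists' Hermite polynomial as an element of `ℝ[X]`, given by the recursion
`P₀ = 1`, `P_{n+1} = 2 X P_n - P_n'`. -/
def hermitePoly : ℕ → ℝ[X]
  | 0 => 1
  | n + 1 => C 2 * X * hermitePoly n - derivative (hermitePoly n)

theorem hasDerivAt_weight (x : ℝ) : HasDerivAt weight (-(2 * x) * weight x) x := by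
  have h1 : HasDerivAt (fun y : ℝ => -y ^ 2) (-(2 * x)) x := by
    simpa using (hasDerivAt_pow 2 x).fun_neg
  have h2 := h1.exp
  rw [mul_comm] at h2
  exact h2

theorem hasDerivAt_poly_mul_weight (n : ℕ) (x : ℝ) :
    HasDerivAt (fun y => (hermitePoly n).eval y * weight y)
      (-((hermitePoly (n + 1)).eval x * weight x)) x := by
  refine (((hermitePoly n).hasDerivAt x).fun_mul (hasDerivAt_weight x)).congr_deriv ?_
  simp only [hermitePoly, eval_sub, eval_mul, eval_C, eval_X]
  ring

theorem iteratedDeriv_weight (n : ℕ) :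
    iteratedDeriv n weight = fun x => (-1) ^ n * ((hermitePoly n).eval x * weight x) := by
  induction n with
  | zero => funext x; simp [hermitePoly]
  | succ n ih =>
    funext x
    rw [iteratedDeriv_succ, ih, ((hasDerivAt_poly_mul_weight n x).const_mul _).deriv]
    ring

theorem weight_pos (x : ℝ) : 0 < weight x := Real.exp_pos _

theorem hermiteH_eq_eval (n : ℕ) (x : ℝ) : hermiteH n x = (hermitePoly n).eval x := by
  have := (weight_pos x).ne'
  have h : ((-1 : ℝ) ^ n) * (-1) ^ n = 1 := by rw [← mul_pow]; simp
  rw [hermiteH, iteratedDeriv_weight]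
  field_simp
  linear_combination (hermitePoly n).eval x * h

theorem derivative_hermitePoly_succ (n : ℕ) :
    derivative (hermitePoly (n + 1)) = C (2 * ((n : ℝ) + 1)) * hermitePoly n := by
  induction n with
  | zero => simp [hermitePoly]
  | succ n ih =>
    have e : hermitePoly (n + 1) = C 2 * X * hermitePoly n - derivative (hermitePoly n) := rfl
    rw [show hermitePoly (n + 1 + 1)
      = C 2 * X * hermitePoly (n + 1) - derivative (hermitePoly (n + 1)) from rfl]
    rw [derivative_sub, derivative_mul, derivative_mul, ih, derivative_mul, derivative_C,
      derivative_C, derivative_X]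
    rw [e]
    simp only [map_add, map_mul, map_natCast, Nat.cast_add, Nat.cast_one, map_one]
    ring

theorem iterate_derivative_hermitePoly (n : ℕ) :
    derivative^[n] (hermitePoly n) = C (2 ^ n * (n.factorial : ℝ)) := by
  induction n with
  | zero => simp [hermitePoly]
  | succ n ih =>
    rw [Function.iterate_succ_apply, derivative_hermitePoly_succ, iterate_derivative_C_mul, ih,
      ← C_mul, Nat.factorial_succ]
    congr 1
    push_cast
    ring

theorem iterate_derivative_hermitePoly_of_lt {m n : ℕ} (h : m < n) :
    derivative^[n] (hermitePoly m) = 0 := by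
  obtain ⟨k, rfl⟩ := Nat.exists_eq_add_of_lt h
  rw [show m + k + 1 = k + 1 + m by ring, Function.iterate_add_apply,
    iterate_derivative_hermitePoly, Function.iterate_succ_apply, derivative_C,
    iterate_derivative_zero]

/-! ### Orthonormality of the Hermite functions -/

theorem integral_mul_hermitePoly_succ (q : ℝ[X]) (n : ℕ) :
    ∫ x, q.eval x * ((hermitePoly (n + 1)).eval x * weight x) =
      ∫ x, (derivative q).eval x * ((hermitePoly n).eval x * weight x) := by
  have hint : ∀ p r : ℝ[X], Integrable (fun x => p.eval x * (r.eval x * weight x)) := fun p r => by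
    simpa [weight, mul_assoc] using integrable_poly_mul_gaussian (p * r)
  have h := integral_mul_deriv_eq_deriv_mul_of_integrable (u := fun x => q.eval x)
    (v := fun x => (hermitePoly n).eval x * weight x) (u' := fun x => (derivative q).eval x)
    (v' := fun x => -((hermitePoly (n + 1)).eval x * weight x))
    (fun x _ => q.hasDerivAt x) (fun x _ => hasDerivAt_poly_mul_weight n x)
    (by simpa [Pi.mul_def] using (hint q (hermitePoly (n + 1))).neg) (hint _ _) (hint _ _)
  simp only [mul_neg, integral_neg] at h
  linarith

/-- Integration by parts `n` times moves all derivatives onto `q`. -/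
theorem integral_mul_hermitePoly (q : ℝ[X]) (n : ℕ) :
    ∫ x, q.eval x * ((hermitePoly n).eval x * weight x) =
      ∫ x, (derivative^[n] q).eval x * weight x := by
  induction n generalizing q with
  | zero => simp [hermitePoly]
  | succ n ih => rw [integral_mul_hermitePoly_succ, ih, Function.iterate_succ_apply]

theorem integral_weight : ∫ x, weight x = √Real.pi := by
  simpa [weight] using integral_gaussian 1

theorem gammaNorm_pos (n : ℕ) : 0 < gammaNorm n := by
  unfold gammaNorm; positivity

theorem integral_hermitePoly_mul (m n : ℕ) :
    ∫ x, (hermitePoly m).eval x * ((hermitePoly n).eval x * weight x) =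
      if m = n then gammaNorm n else 0 := by
  rcases lt_trichotomy m n with h | h | h
  · rw [integral_mul_hermitePoly, iterate_derivative_hermitePoly_of_lt h, if_neg h.ne]
    simp
  · subst h
    rw [integral_mul_hermitePoly, iterate_derivative_hermitePoly, if_pos rfl]
    simp only [eval_C]
    rw [integral_const_mul, integral_weight, gammaNorm]
  · rw [if_neg h.ne']
    have : ∀ x, (hermitePoly m).eval x * ((hermitePoly n).eval x * weight x) =
      (hermitePoly n).eval x * ((hermitePoly m).eval x * weight x) := fun x => by ring
    simp_rw [this]
    rw [integral_mul_hermitePoly, iterate_derivative_hermitePoly_of_lt h]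
    simp

theorem exp_half_mul_self (x : ℝ) :
    Real.exp (-x ^ 2 / 2) * Real.exp (-x ^ 2 / 2) = weight x := by
  rw [← Real.exp_add, weight]; congr 1; ring

theorem hermitePsi_eq (n : ℕ) (x : ℝ) :
    hermitePsi n x = Real.exp (-x ^ 2 / 2) * (hermitePoly n).eval x / √(gammaNorm n) := by
  rw [hermitePsi, hermiteH_eq_eval]

theorem integral_hermitePsi_mul (m n : ℕ) :
    ∫ x, hermitePsi m x * hermitePsi n x = if m = n then 1 else 0 := by
  have : ∀ x, hermitePsi m x * hermitePsi n x = (√(gammaNorm m) * √(gammaNorm n))⁻¹ *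
      ((hermitePoly m).eval x * ((hermitePoly n).eval x * weight x)) := fun x => by
    rw [hermitePsi_eq, hermitePsi_eq, ← exp_half_mul_self]
    have := (Real.sqrt_pos.2 (gammaNorm_pos m)).ne'
    have := (Real.sqrt_pos.2 (gammaNorm_pos n)).ne'
    field_simp
  simp_rw [this]
  rw [integral_const_mul, integral_hermitePoly_mul]
  split_ifs with h
  · subst h
    rw [Real.mul_self_sqrt (gammaNorm_pos m).le, inv_mul_cancel₀ (gammaNorm_pos m).ne']
  · simp

/-- The Hermite function `ψ_n` as an element of `L²(ℝ)`. -/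
def psiLp (n : ℕ) : Lp ℂ 2 (volume : Measure ℝ) := (memLp_hermitePsi n).toLp _

theorem inner_psiLp_toLp {g : ℝ → ℂ} (hg : MemLp g 2 volume) (n : ℕ) :
    inner ℂ (psiLp n) (hg.toLp g) = hermiteCoeff g n := by
  rw [MeasureTheory.L2.inner_def, hermiteCoeff]
  refine integral_congr_ae ?_
  filter_upwards [hg.coeFn_toLp, (memLp_hermitePsi n).coeFn_toLp] with x h1 h2
  rw [h1, psiLp, h2]
  simp

theorem orthonormal_psiLp : Orthonormal ℂ psiLp := by
  rw [orthonormal_iff_ite]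
  intro m n
  rw [show psiLp n = (memLp_hermitePsi n).toLp _ from rfl, inner_psiLp_toLp, hermiteCoeff]
  have := integral_hermitePsi_mul n m
  rw [← Complex.ofReal_inj, ← integral_complex_ofReal] at this
  push_cast at this
  rw [this]
  by_cases h : m = n <;> simp [h, eq_comm]

/-! ### Completeness of the Hermite functions -/

/-- The recurrence `2 x H_n = H_{n+1} + H_n'` passes from the Hermite coefficients to the moments of
`h exp (-x ^ 2 / 2)`. -/
theorem integral_mul_pow_mul_exp_eq_zero {h : ℝ → ℂ} (hh : MemLp h 2 volume)
    (h0 : ∀ n, hermiteCoeff h n = 0) (k : ℕ) :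
    ∫ x : ℝ, h x * ((x ^ k * Real.exp (-x ^ 2 / 2) : ℝ) : ℂ) = 0 := by
  have key : ∀ j n : ℕ, Integrable (fun x : ℝ => h x *
        ((x ^ j * (hermitePoly n).eval x * Real.exp (-x ^ 2 / 2) : ℝ) : ℂ)) ∧
      ∫ x : ℝ, h x * ((x ^ j * (hermitePoly n).eval x * Real.exp (-x ^ 2 / 2) : ℝ) : ℂ) = 0 := by
    intro j
    induction j with
    | zero =>
      intro n
      have hne : √(gammaNorm n) ≠ 0 := (Real.sqrt_pos.2 (gammaNorm_pos n)).ne'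
      have e : ∀ x : ℝ, h x * ((x ^ 0 * (hermitePoly n).eval x * Real.exp (-x ^ 2 / 2) : ℝ) : ℂ)
          = (h x * (hermitePsi n x : ℂ)) * (√(gammaNorm n) : ℂ) := fun x => by
        rw [hermitePsi_eq, mul_assoc (h x), ← Complex.ofReal_mul]
        congr 2
        field_simp
      have hi : Integrable (fun x : ℝ => h x * (hermitePsi n x : ℂ)) :=
        hh.integrable_mul (memLp_hermitePsi n)
      simp_rw [e]
      refine ⟨hi.mul_const _, ?_⟩
      rw [integral_mul_const, show ∫ x : ℝ, h x * (hermitePsi n x : ℂ) = 0 from h0 n, zero_mul]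
    | succ j ih =>
      have e : ∀ (n : ℕ) (x : ℝ), (hermitePoly (n + 1)).eval x
          + (derivative (hermitePoly n)).eval x = 2 * x * (hermitePoly n).eval x := fun n x => by
        simp [hermitePoly]
      intro n
      have hd : ∃ c : ℝ, ∃ m : ℕ, derivative (hermitePoly n) = C c * hermitePoly m := by
        cases n with
        | zero => exact ⟨0, 0, by simp [hermitePoly]⟩
        | succ n => exact ⟨_, n, derivative_hermitePoly_succ n⟩
      obtain ⟨c, m, hcm⟩ := hd
      have e2 : ∀ x : ℝ, h x *
          ((x ^ (j + 1) * (hermitePoly n).eval x * Real.exp (-x ^ 2 / 2) : ℝ) : ℂ) =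
          (1 / 2) * (h x * ((x ^ j * (hermitePoly (n + 1)).eval x * Real.exp (-x ^ 2 / 2) : ℝ) : ℂ))
          + (c / 2) *
            (h x * ((x ^ j * (hermitePoly m).eval x * Real.exp (-x ^ 2 / 2) : ℝ) : ℂ)) := by
        intro x
        have := e n x
        rw [hcm, eval_mul, eval_C] at this
        have h2 : (((hermitePoly (n + 1)).eval x : ℝ) : ℂ) + c * ((hermitePoly m).eval x : ℝ)
          = 2 * x * ((hermitePoly n).eval x : ℝ) := by exact_mod_cast this
        push_cast
        linear_combination (-(1 / 2 : ℂ)) * h x * x ^ j * Complex.exp (-x ^ 2 / 2) * h2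
      simp_rw [e2]
      have i1 := (ih (n + 1)).1.const_mul (1 / 2 : ℂ)
      have i2 := (ih m).1.const_mul (c / 2 : ℂ)
      refine ⟨i1.add i2, ?_⟩
      rw [integral_add i1 i2, integral_const_mul, integral_const_mul, (ih _).2, (ih _).2]
      simp
  simpa [hermitePoly] using (key k 0).2

theorem memLp_exp_abs_mul_gaussian (c : ℝ) :
    MemLp (fun x : ℝ => Real.exp (c * |x|) * Real.exp (-x ^ 2 / 2)) 2 volume := by
  have hc : Continuous fun x : ℝ => Real.exp (c * |x|) * Real.exp (-x ^ 2 / 2) := by fun_prop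
  rw [memLp_two_iff_integrable_sq hc.aestronglyMeasurable]
  refine ((integrable_exp_neg_mul_sq (b := 1 / 2) (by norm_num)).const_mul
    (Real.exp (2 * c ^ 2))).mono' (by fun_prop) (Eventually.of_forall fun x => ?_)
  rw [Real.norm_of_nonneg (by positivity), mul_pow, ← Real.exp_nat_mul, ← Real.exp_nat_mul,
    ← Real.exp_add, ← Real.exp_add]
  refine Real.exp_le_exp.2 ?_
  push_cast
  nlinarith [sq_nonneg (2 * c - |x|), sq_abs x]

/-- Expanding the exponential into its power series, under the bound `exp (|w| |x|)`, reduces the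
Laplace transform of `h exp (-x ^ 2 / 2)` to its moments. -/
theorem integral_mul_exp_eq_zero {h : ℝ → ℂ} (hh : MemLp h 2 volume)
    (h0 : ∀ n, hermiteCoeff h n = 0) (w : ℂ) :
    ∫ x : ℝ, Complex.exp (w * x) * (h x * (Real.exp (-x ^ 2 / 2) : ℂ)) = 0 := by
  have hint : Integrable (fun x : ℝ =>
      ‖h x‖ * (Real.exp (‖w‖ * |x|) * Real.exp (-x ^ 2 / 2))) :=
    hh.norm.integrable_mul (memLp_exp_abs_mul_gaussian ‖w‖)
  have hs := hasSum_integral_of_dominated_convergence (μ := (volume : Measure ℝ))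
    (F := fun (k : ℕ) (x : ℝ) => (w * x) ^ k / (k.factorial : ℂ) *
      (h x * (Real.exp (-x ^ 2 / 2) : ℂ)))
    (f := fun x : ℝ => Complex.exp (w * x) * (h x * (Real.exp (-x ^ 2 / 2) : ℂ)))
    (fun k x => (‖w‖ * |x|) ^ k / (k.factorial : ℝ) * (‖h x‖ * Real.exp (-x ^ 2 / 2)))
    (fun k => by
      have := hh.1
      refine AEStronglyMeasurable.mul (by fun_prop) (this.mul (by fun_prop)))
    (fun k => Eventually.of_forall fun x => by
      simp only [norm_mul, norm_div, norm_pow, Complex.norm_real, Real.norm_eq_abs,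
        Complex.norm_natCast, Real.abs_exp, le_refl])
    (Eventually.of_forall fun x => (Real.summable_pow_div_factorial _).mul_right _)
    (by
      refine hint.congr (Eventually.of_forall fun x => ?_)
      simp only
      rw [tsum_mul_right, ← congrFun (NormedSpace.exp_eq_tsum_div (𝔸 := ℝ)) (‖w‖ * |x|),
        ← Real.exp_eq_exp_ℝ]
      ring)
    (Eventually.of_forall fun x => by
      refine HasSum.mul_right _ ?_
      rw [Complex.exp_eq_exp_ℂ]
      exact NormedSpace.expSeries_div_hasSum_exp (w * x))
  have hz : ∀ k : ℕ, ∫ x : ℝ, (w * x) ^ k / (k.factorial : ℂ) *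
      (h x * (Real.exp (-x ^ 2 / 2) : ℂ)) = 0 := fun k => by
    have e : ∀ x : ℝ, (w * x) ^ k / (k.factorial : ℂ) * (h x * (Real.exp (-x ^ 2 / 2) : ℂ)) =
      w ^ k / (k.factorial : ℂ) * (h x * ((x ^ k * Real.exp (-x ^ 2 / 2) : ℝ) : ℂ)) := fun x => by
      push_cast
      ring
    simp_rw [e]
    rw [integral_const_mul, integral_mul_pow_mul_exp_eq_zero hh h0, mul_zero]
  simp only [hz] at hs
  exact hs.unique hasSum_zero

open FourierTransform in
/-- An integrable function with vanishing Fourier transform vanishes almost everywhere: test it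
against `φ = 𝓕 (𝓕⁻ φ)` and move the transform over. -/
theorem ae_eq_zero_of_fourier_eq_zero {g : ℝ → ℂ} (hg : Integrable g)
    (h0 : ∀ w : ℝ, 𝓕 g w = 0) : g =ᵐ[volume] 0 := by
  refine ae_eq_zero_of_integral_contDiff_smul_eq_zero hg.locallyIntegrable fun φ hφ hc => ?_
  have hg₁ : HasCompactSupport (Complex.ofRealCLM ∘ φ) := hc.comp_left rfl
  have hg₂ : ContDiff ℝ (⊤ : ℕ∞) (Complex.ofRealCLM ∘ φ) := by
    exact Complex.ofRealCLM.contDiff.comp hφ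
  let Φ : SchwartzMap ℝ ℂ := hg₁.toSchwartzMap hg₂
  have hflip := VectorFourier.integral_fourierIntegral_smul_eq_flip (μ := (volume : Measure ℝ))
    (ν := (volume : Measure ℝ)) (L := innerₗ ℝ) (f := g) (g := (𝓕⁻ Φ : SchwartzMap ℝ ℂ))
    Real.continuous_fourierChar continuous_inner hg (SchwartzMap.integrable _)
  have hl : ∀ w : ℝ, VectorFourier.fourierIntegral Real.fourierChar volume (innerₗ ℝ) g w = 0 := h0
  have hr : ∀ x : ℝ, VectorFourier.fourierIntegral Real.fourierChar volume (innerₗ ℝ).flip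
      (𝓕⁻ Φ : SchwartzMap ℝ ℂ) x = (φ x : ℂ) := fun x => by
    have h1 : 𝓕 (𝓕⁻ Φ : SchwartzMap ℝ ℂ) = Φ := FourierTransform.fourier_fourierInv_eq Φ
    have h2 := congrArg (fun F : SchwartzMap ℝ ℂ => F x) h1
    simp only [SchwartzMap.fourier_coe] at h2
    rw [flip_innerₗ]
    exact h2
  simp only [hl, hr, zero_smul, integral_zero] at hflip
  rw [hflip]
  refine integral_congr_ae (Eventually.of_forall fun x => ?_)
  simp [mul_comm]

/-- Completeness of the Hermite functions, by injectivity of the Fourier transform. -/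
theorem eq_zero_of_hermiteCoeff_eq_zero {h : ℝ → ℂ} (hh : MemLp h 2 volume)
    (h0 : ∀ n, hermiteCoeff h n = 0) : h =ᵐ[volume] 0 := by
  have hi : Integrable (fun x : ℝ => h x * (Real.exp (-x ^ 2 / 2) : ℂ)) := by
    have h1 := (memLp_exp_abs_mul_gaussian 0).ofReal (K := ℂ)
    simp only [zero_mul, Real.exp_zero, one_mul] at h1
    exact hh.integrable_mul h1
  have := ae_eq_zero_of_fourier_eq_zero hi fun w => by
    rw [Real.fourier_real_eq_integral_exp_smul]
    have := integral_mul_exp_eq_zero hh h0 (-2 * Real.pi * w * Complex.I)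
    rw [← this]
    refine integral_congr_ae (Eventually.of_forall fun x => ?_)
    simp only [smul_eq_mul]
    congr 2
    push_cast
    ring
  filter_upwards [this] with x hx
  simpa [Complex.exp_ne_zero] using hx

theorem span_psiLp_orthogonal : (Submodule.span ℂ (Set.range psiLp))ᗮ = ⊥ := by
  rw [Submodule.eq_bot_iff]
  intro v hv
  have hcoeff : ∀ n, hermiteCoeff v n = 0 := fun n => by
    rw [← inner_psiLp_toLp (Lp.memLp v), Lp.toLp_coeFn]
    exact (Submodule.mem_orthogonal _ v).1 hv _ (Submodule.subset_span ⟨n, rfl⟩)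
  exact (Lp.eq_zero_iff_ae_eq_zero).2 (eq_zero_of_hermiteCoeff_eq_zero (Lp.memLp v) hcoeff)

/-! ### The projection onto the Hermite spaces -/

theorem hermiteProj_toLp {g : ℝ → ℂ} (hg : MemLp g 2 volume) (n : ℕ) :
    hermiteProj n (hg.toLp g) = ∑ k ∈ Finset.range (n + 1), hermiteCoeff g k • psiLp k := by
  have hrange : (Set.range fun k : Fin (n + 1) => (memLp_hermitePsi k).toLp _) =
    Set.range fun k : Fin (n + 1) => psiLp k := rfl
  refine Submodule.eq_starProjection_of_mem_of_inner_eq_zero ?_ ?_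
  · refine Submodule.sum_mem _ fun k hk => Submodule.smul_mem _ _ (Submodule.subset_span ?_)
    exact ⟨⟨k, Finset.mem_range.1 hk⟩, rfl⟩
  · intro w hw
    rw [hermiteSpace, hrange] at hw
    induction hw using Submodule.span_induction with
    | mem x hx =>
      obtain ⟨j, rfl⟩ := hx
      rw [inner_eq_zero_symm, inner_sub_right, inner_psiLp_toLp,
        orthonormal_psiLp.inner_right_sum _ (Finset.mem_range.2 j.2), sub_self]
    | zero => simp
    | add x y _ _ hx hy => rw [inner_add_right, hx, hy, add_zero]
    | smul a x _ hx => rw [inner_smul_right, hx, mul_zero]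

theorem sum_smul_psiLp_ae (c : ℕ → ℂ) (s : Finset ℕ) :
    ((∑ k ∈ s, c k • psiLp k : Lp ℂ 2 (volume : Measure ℝ)) : ℝ → ℂ) =ᵐ[volume]
      fun x => ∑ k ∈ s, c k * (hermitePsi k x : ℂ) := by
  have h1 := Lp.coeFn_fun_finsetSum s fun k => c k • psiLp k
  refine h1.trans ?_
  have h2 : ∀ k ∈ s, ∀ᵐ x ∂(volume : Measure ℝ),
      (c k • psiLp k : Lp ℂ 2 (volume : Measure ℝ)) x = c k * (hermitePsi k x : ℂ) := fun k _ => by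
    filter_upwards [Lp.coeFn_smul (c k) (psiLp k), (memLp_hermitePsi k).coeFn_toLp] with x h3 h4
    rw [h3, Pi.smul_apply, psiLp, h4, smul_eq_mul]
  filter_upwards [(ae_ball_iff s.countable_toSet).2 h2] with x hx
  exact Finset.sum_congr rfl fun k hk => hx k hk

theorem tendsto_hermiteProj (v : Lp ℂ 2 (volume : Measure ℝ)) :
    Tendsto (fun N => hermiteProj N v) atTop (𝓝 v) := by
  let b := HilbertBasis.mkOfOrthogonalEqBot orthonormal_psiLp span_psiLp_orthogonal
  have hb : ∀ k, b k = psiLp k := fun k => by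
    rw [HilbertBasis.coe_mkOfOrthogonalEqBot]
  have h := (b.hasSum_repr v).tendsto_sum_nat.comp (tendsto_add_atTop_nat 1)
  refine h.congr fun N => ?_
  conv_rhs => rw [← Lp.toLp_coeFn v (Lp.memLp v), hermiteProj_toLp (Lp.memLp v)]
  refine Finset.sum_congr rfl fun k _ => ?_
  rw [b.repr_apply_apply, hb, ← inner_psiLp_toLp (Lp.memLp v), Lp.toLp_coeFn]

end Hermite

/-! ### Contour integrals over horizontal lines -/

/-- Cauchy's theorem for a horizontal strip: if `G` is holomorphic between the lines `Im z = a` and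
`Im z = b` and tends to zero at the ends of the strip, then the integral over both lines, taken
with opposite orientations, vanishes. -/
theorem integral_line_sub_line_eq_zero {G : ℂ → ℂ} {a b : ℝ}
    (hG : DifferentiableOn ℂ G {z | z.im ∈ Set.uIcc a b}) {B : ℝ → ℝ}
    (hB : ∀ᶠ x : ℝ in cocompact ℝ, ∀ y ∈ Set.uIcc a b, ‖G (x + y * Complex.I)‖ ≤ B x)
    (hB0 : Tendsto B (cocompact ℝ) (𝓝 0))
    (hint : Integrable fun x : ℝ => G (x + a * Complex.I) - G (x + b * Complex.I)) :
    ∫ x : ℝ, (G (x + a * Complex.I) - G (x + b * Complex.I)) = 0 := by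
  have hcont : ∀ c ∈ Set.uIcc a b, Continuous fun x : ℝ => G (x + c * Complex.I) := fun c hc => by
    refine hG.continuousOn.comp_continuous (by fun_prop) fun x => ?_
    simpa using hc
  rw [cocompact_eq_atBot_atTop] at hB0 hB
  have hBTop := hB.filter_mono le_sup_right
  have hBBot := tendsto_neg_atTop_atBot.eventually (hB.filter_mono le_sup_left)
  have hTop : Tendsto B atTop (𝓝 0) := hB0.mono_left le_sup_right
  have hBot : Tendsto (fun T => B (-T)) atTop (𝓝 0) :=
    (hB0.mono_left le_sup_left).comp tendsto_neg_atTop_atBot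
  have hlim := intervalIntegral_tendsto_integral hint tendsto_neg_atTop_atBot tendsto_id
  refine tendsto_nhds_unique hlim (squeeze_zero_norm' (a := fun T => (B T + B (-T)) * |b - a|)
    ?_ (by simpa using (hTop.add hBot).mul_const |b - a|))
  filter_upwards [hBTop, hBBot] with T hT hT'
  have hrect := Complex.integral_boundary_rect_eq_zero_of_differentiableOn G
    (-T + a * Complex.I) (T + b * Complex.I) (hG.mono fun z hz => by
      have := (Complex.mem_reProdIm.1 hz).2
      simpa using this)
  simp only [Complex.add_re, Complex.neg_re, Complex.ofReal_re, Complex.mul_re, Complex.I_re,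
    mul_zero, Complex.ofReal_im, Complex.I_im, mul_one, sub_self, add_zero, Complex.add_im,
    Complex.neg_im, Complex.mul_im, zero_add, neg_zero, Complex.ofReal_neg] at hrect
  have hv : ∀ c : ℝ, (∀ y ∈ Set.uIcc a b, ‖G (c + y * Complex.I)‖ ≤ B c) →
      ‖∫ y in a..b, G (c + y * Complex.I)‖ ≤ B c * |b - a| := fun c hc =>
    intervalIntegral.norm_integral_le_of_norm_le_const fun y hy =>
      hc y (Set.uIoc_subset_uIcc hy)
  have hsub : ∫ x in (-T)..(id T), (G (x + a * Complex.I) - G (x + b * Complex.I)) =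
      (∫ x in (-T)..T, G (x + a * Complex.I)) - ∫ x in (-T)..T, G (x + b * Complex.I) :=
    intervalIntegral.integral_sub ((hcont a Set.left_mem_uIcc).intervalIntegrable _ _)
      ((hcont b Set.right_mem_uIcc).intervalIntegrable _ _)
  have e : (∫ x in (-T)..T, G (x + a * Complex.I)) - ∫ x in (-T)..T, G (x + b * Complex.I) =
      Complex.I * (∫ y in a..b, G (-T + y * Complex.I))
      - Complex.I * ∫ y in a..b, G (T + y * Complex.I) := by
    simp only [smul_eq_mul] at hrect
    linear_combination hrect
  rw [hsub, e]
  refine (norm_sub_le _ _).trans ?_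
  have h1 := hv T hT
  have h2 := hv (-T) hT'
  push_cast at h2
  rw [norm_mul, norm_mul, Complex.norm_I, one_mul, one_mul]
  linarith

theorem norm_cexp_neg_sq_line (v h : ℝ) :
    ‖Complex.exp (-(v + h * Complex.I) ^ 2)‖ = Real.exp (h ^ 2) * Real.exp (-v ^ 2) := by
  rw [Complex.norm_exp, ← Real.exp_add]
  congr 1
  simp [sq, Complex.mul_re, Complex.mul_im]
  ring

theorem le_norm_line_sub (v h x : ℝ) : |h| ≤ ‖(v + h * Complex.I - x : ℂ)‖ := by
  have := Complex.abs_im_le_norm (v + h * Complex.I - x : ℂ)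
  simpa using this

theorem line_sub_ne_zero {h : ℝ} (hh : h ≠ 0) (v x : ℝ) : (v + h * Complex.I - x : ℂ) ≠ 0 :=
  norm_pos_iff.1 ((abs_pos.2 hh).trans_le (le_norm_line_sub v h x))

/-- The integral of `exp (-s ^ 2) / (s - x) ^ (n + 1)` over the line `Im s = h`. -/
def lineKernel (h : ℝ) (n : ℕ) (x : ℝ) : ℂ :=
  ∫ v : ℝ, Complex.exp (-(v + h * Complex.I) ^ 2) / (v + h * Complex.I - x) ^ (n + 1)

theorem continuous_lineKernel_integrand {h : ℝ} (hh : h ≠ 0) (n : ℕ) :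
    Continuous fun p : ℝ × ℝ =>
      Complex.exp (-(p.2 + h * Complex.I) ^ 2) / (p.2 + h * Complex.I - p.1) ^ (n + 1) := by
  refine Continuous.div (by fun_prop) (by fun_prop) fun p => pow_ne_zero _ (line_sub_ne_zero hh _ _)

theorem norm_lineKernel_integrand_le {h : ℝ} (hh : h ≠ 0) (n : ℕ) (x v : ℝ) :
    ‖Complex.exp (-(v + h * Complex.I) ^ 2) / (v + h * Complex.I - x) ^ (n + 1)‖ ≤
      Real.exp (h ^ 2) / |h| ^ (n + 1) * Real.exp (-v ^ 2) := by
  rw [norm_div, norm_cexp_neg_sq_line, norm_pow, mul_div_right_comm]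
  have := le_norm_line_sub v h x
  have := abs_pos.2 hh
  gcongr

theorem integrable_exp_neg_sq : Integrable fun v : ℝ => Real.exp (-v ^ 2) := by
  simpa using integrable_exp_neg_mul_sq (b := 1) one_pos

theorem integrable_lineKernel_integrand {h : ℝ} (hh : h ≠ 0) (n : ℕ) (x : ℝ) :
    Integrable fun v : ℝ =>
      Complex.exp (-(v + h * Complex.I) ^ 2) / (v + h * Complex.I - x) ^ (n + 1) :=
  (integrable_exp_neg_sq.const_mul _).mono'
    ((continuous_lineKernel_integrand hh n).comp
      (Continuous.prodMk_right x)).aestronglyMeasurable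
    (Eventually.of_forall fun v => norm_lineKernel_integrand_le hh n x v)

theorem hasDerivAt_lineKernel {h : ℝ} (hh : h ≠ 0) (n : ℕ) (x : ℝ) :
    HasDerivAt (lineKernel h n) ((n + 1) * lineKernel h (n + 1) x) x := by
  have key := hasDerivAt_integral_of_dominated_loc_of_deriv_le (μ := (volume : Measure ℝ))
    (F := fun (x : ℝ) (v : ℝ) =>
      Complex.exp (-(v + h * Complex.I) ^ 2) / (v + h * Complex.I - x) ^ (n + 1))
    (F' := fun (x : ℝ) (v : ℝ) => (n + 1) *
      (Complex.exp (-(v + h * Complex.I) ^ 2) / (v + h * Complex.I - x) ^ (n + 1 + 1)))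
    (x₀ := x) (s := Set.univ) (bound := fun v => (n + 1) *
      (Real.exp (h ^ 2) / |h| ^ (n + 1 + 1) * Real.exp (-v ^ 2))) univ_mem
    (Eventually.of_forall fun y => (integrable_lineKernel_integrand hh n y).1)
    (integrable_lineKernel_integrand hh n x)
    ((integrable_lineKernel_integrand hh (n + 1) x).const_mul _).1
    (Eventually.of_forall fun v y _ => by
      rw [norm_mul]
      have : ‖(n + 1 : ℂ)‖ = n + 1 := by exact_mod_cast Complex.norm_natCast (n + 1)
      rw [this]
      gcongr
      exact norm_lineKernel_integrand_le hh (n + 1) y v)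
    ((integrable_exp_neg_sq.const_mul _).const_mul _)
    (Eventually.of_forall fun v y _ => by
      have h1 : HasDerivAt (fun y : ℝ => (v + h * Complex.I - y : ℂ)) (-1) y := by
        simpa using (Complex.ofRealCLM.hasDerivAt (x := y)).const_sub (v + h * Complex.I : ℂ)
      have hne := line_sub_ne_zero hh v y
      refine ((h1.fun_pow (n + 1)).fun_inv (pow_ne_zero _ hne)
        |>.const_mul (Complex.exp (-(v + h * Complex.I) ^ 2))).congr_deriv ?_
      push_cast
      field_simp
      simp [pow_succ]
      ring)
  rw [integral_const_mul] at key
  exact key.2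

theorem integral_cauchy_kernel {η : ℝ} (hη : 0 < η) (x : ℝ) :
    Integrable (fun v : ℝ => 2 * η / ((v - x) ^ 2 + η ^ 2)) ∧
      ∫ v : ℝ, 2 * η / ((v - x) ^ 2 + η ^ 2) = 2 * Real.pi := by
  have e : ∀ v : ℝ, 2 * η / (v ^ 2 + η ^ 2) = 2 / η * (1 + (v / η) ^ 2)⁻¹ := fun v => by
    field_simp
    ring
  have hi : Integrable fun v : ℝ => 2 * η / (v ^ 2 + η ^ 2) := by
    simp_rw [e]
    exact (integrable_inv_one_add_sq.comp_div hη.ne').const_mul _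
  refine ⟨hi.comp_sub_right x, ?_⟩
  rw [integral_sub_right_eq_self (fun v : ℝ => 2 * η / (v ^ 2 + η ^ 2))]
  simp_rw [e]
  rw [integral_const_mul, Measure.integral_comp_div (fun v : ℝ => (1 + v ^ 2)⁻¹),
    integral_univ_inv_one_add_sq, abs_of_pos hη, smul_eq_mul]
  field_simp

/-- Cauchy's integral formula for `exp (-s ^ 2)` on a strip. The quotient
`(exp (-s ^ 2) - exp (-x ^ 2)) / (s - x)` is entire and tends to zero at the ends of the strip; the
remaining multiple of `1 / (s - x)` contributes the integral of the Cauchy density. -/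
theorem lineKernel_zero_sub {η : ℝ} (hη : 0 < η) (x : ℝ) :
    lineKernel (-η) 0 x - lineKernel η 0 x = 2 * Real.pi * Complex.I * (weight x : ℂ) := by
  set E : ℂ → ℂ := fun s => Complex.exp (-s ^ 2) with hE
  have hEd : Differentiable ℂ E := by fun_prop
  set G : ℂ → ℂ := dslope E x with hGdef
  have hGd : Differentiable ℂ G := by
    rw [← differentiableOn_univ] at hEd ⊢
    exact (Complex.differentiableOn_dslope univ_mem).2 hEd
  have hw : E x = (weight x : ℂ) := by simp [hE, weight]
  have hGe : ∀ s : ℂ, s ≠ x → G s = E s / (s - x) - weight x / (s - x) := fun s hs => by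
    rw [hGdef, dslope_of_ne _ hs, slope_def_field, hw, sub_div]
  have hηn : -η ≠ 0 := neg_ne_zero.2 hη.ne'
  have hlow : ∀ v : ℝ, G (v + (-η : ℝ) * Complex.I) =
      E (v + (-η : ℝ) * Complex.I) / (v + (-η : ℝ) * Complex.I - x)
      - weight x / (v + (-η : ℝ) * Complex.I - x) := fun v =>
    hGe _ (sub_ne_zero.1 (line_sub_ne_zero hηn v x))
  have hup : ∀ v : ℝ, G (v + η * Complex.I) = E (v + η * Complex.I) / (v + η * Complex.I - x)
      - weight x / (v + η * Complex.I - x) := fun v =>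
    hGe _ (sub_ne_zero.1 (line_sub_ne_zero hη.ne' v x))
  have hker : ∀ v : ℝ, (weight x / (v + (-η : ℝ) * Complex.I - x) -
      weight x / (v + η * Complex.I - x)
      : ℂ) = (Complex.I * weight x) * ((2 * η / ((v - x) ^ 2 + η ^ 2) : ℝ) : ℂ) := fun v => by
    have h1 := line_sub_ne_zero hηn v x
    have h2 := line_sub_ne_zero hη.ne' v x
    have h3 : ((v - x : ℂ) ^ 2 + η ^ 2) ≠ 0 := by
      have : (0 : ℝ) < (v - x) ^ 2 + η ^ 2 := by positivity
      exact_mod_cast this.ne'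
    push_cast at h1 h2 ⊢
    rw [div_sub_div _ _ h1 h2, mul_div_assoc', div_eq_div_iff (mul_ne_zero h1 h2) h3]
    linear_combination (2 * weight x * η ^ 3 * Complex.I) * Complex.I_sq
  have hi1 : Integrable fun v : ℝ =>
      E (v + (-η : ℝ) * Complex.I) / (v + (-η : ℝ) * Complex.I - x) := by
    simpa only [zero_add, pow_one] using integrable_lineKernel_integrand hηn 0 x
  have hi2 : Integrable fun v : ℝ => E (v + η * Complex.I) / (v + η * Complex.I - x) := by
    simpa only [zero_add, pow_one] using integrable_lineKernel_integrand hη.ne' 0 x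
  have hi12 : Integrable fun v : ℝ =>
      E (v + (-η : ℝ) * Complex.I) / (v + (-η : ℝ) * Complex.I - x)
        - E (v + η * Complex.I) / (v + η * Complex.I - x) := hi1.sub hi2
  have hi3 : Integrable fun v : ℝ =>
      (Complex.I * weight x) * ((2 * η / ((v - x) ^ 2 + η ^ 2) : ℝ) : ℂ) :=
    ((integral_cauchy_kernel hη x).1.ofReal (𝕜 := ℂ)).const_mul (Complex.I * weight x)
  have hsplit : ∀ v : ℝ, G (v + (-η : ℝ) * Complex.I) - G (v + η * Complex.I) =
      (E (v + (-η : ℝ) * Complex.I) / (v + (-η : ℝ) * Complex.I - x)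
        - E (v + η * Complex.I) / (v + η * Complex.I - x))
      - (Complex.I * weight x) * ((2 * η / ((v - x) ^ 2 + η ^ 2) : ℝ) : ℂ) := fun v => by
    rw [hlow, hup, ← hker]
    ring
  have hbound : ∀ᶠ v : ℝ in cocompact ℝ, ∀ y ∈ Set.uIcc (-η) η,
      ‖G (v + y * Complex.I)‖ ≤ (Real.exp (η ^ 2) + 1) * |v - x|⁻¹ := by
    filter_upwards [(isCompact_singleton (x := x)).compl_mem_cocompact] with v hv y hy
    have hvx : 0 < |v - x| := abs_pos.2 (sub_ne_zero.2 hv)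
    have hre : |v - x| ≤ ‖(v + y * Complex.I - x : ℂ)‖ := by
      simpa using Complex.abs_re_le_norm (v + y * Complex.I - x : ℂ)
    have hne : (v + y * Complex.I : ℂ) ≠ x := by
      rw [← sub_ne_zero, ← norm_pos_iff]
      exact hvx.trans_le hre
    rw [Set.uIcc_of_le (by linarith)] at hy
    have hy2 : y ^ 2 ≤ η ^ 2 := sq_le_sq' hy.1 hy.2
    have hEn : ‖E (v + y * Complex.I)‖ ≤ Real.exp (η ^ 2) := by
      rw [hE, norm_cexp_neg_sq_line, ← Real.exp_add]
      exact Real.exp_le_exp.2 (by nlinarith [sq_nonneg v])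
    have hwn : ‖(weight x : ℂ)‖ ≤ 1 := by
      rw [Complex.norm_real, Real.norm_of_nonneg (weight_pos x).le]
      exact Real.exp_le_one_iff.2 (by nlinarith [sq_nonneg x])
    rw [hGe _ hne, ← sub_div, norm_div, div_eq_mul_inv]
    gcongr
    exact (norm_sub_le _ _).trans (add_le_add hEn hwn)
  have hlim : Tendsto (fun v : ℝ => (Real.exp (η ^ 2) + 1) * |v - x|⁻¹) (cocompact ℝ) (𝓝 0) := by
    have h1 : Tendsto (fun v : ℝ => |v - x|) (cocompact ℝ) atTop :=
      tendsto_norm_cocompact_atTop.comp (Homeomorph.subRight x).isClosedEmbedding.tendsto_cocompact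
    simpa using h1.inv_tendsto_atTop.const_mul (Real.exp (η ^ 2) + 1)
  have hzero := integral_line_sub_line_eq_zero (a := -η) (b := η) hGd.differentiableOn
    hbound hlim (by simp_rw [hsplit]; exact hi12.sub hi3)
  simp_rw [hsplit] at hzero
  rw [integral_sub hi12 hi3, integral_sub hi1 hi2, integral_const_mul,
    integral_complex_ofReal, (integral_cauchy_kernel hη x).2] at hzero
  simp only [lineKernel, zero_add, pow_one]
  push_cast at hzero ⊢
  linear_combination hzero

/-- The derivatives of the Gaussian as differences of two line integrals: Cauchy's formula for the
boundary of the strip `|Im s| ≤ η`, differentiated `n` times. -/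
theorem iteratedDeriv_weight_eq_lineKernel {η : ℝ} (hη : 0 < η) (n : ℕ) (x : ℝ) :
    ((iteratedDeriv n weight x : ℝ) : ℂ) =
      n.factorial / (2 * Real.pi * Complex.I) * (lineKernel (-η) n x - lineKernel η n x) := by
  have hpi : (2 * Real.pi * Complex.I : ℂ) ≠ 0 := by
    simp [Real.pi_ne_zero]
  induction n generalizing x with
  | zero =>
    rw [lineKernel_zero_sub hη]
    simp only [iteratedDeriv_zero, Nat.factorial_zero, Nat.cast_one]
    field_simp
  | succ n ih =>
    have h1 : HasDerivAt (fun y : ℝ => ((iteratedDeriv n weight y : ℝ) : ℂ))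
        ((iteratedDeriv (n + 1) weight x : ℝ) : ℂ) x := by
      refine HasDerivAt.ofReal_comp ?_
      rw [iteratedDeriv_weight, iteratedDeriv_weight]
      refine ((hasDerivAt_poly_mul_weight n x).const_mul _).congr_deriv ?_
      ring
    have h2 := ((hasDerivAt_lineKernel (neg_ne_zero.2 hη.ne') n x).sub
      (hasDerivAt_lineKernel hη.ne' n x)).const_mul
        ((n.factorial : ℂ) / (2 * Real.pi * Complex.I))
    rw [funext ih] at h1
    rw [h1.unique h2, Nat.factorial_succ]
    push_cast
    ring

/-! ### Bounds for the Cauchy kernel -/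

theorem one_add_sq_le_two_mul (x v : ℝ) :
    1 + x ^ 2 ≤ 2 * (1 + v ^ 2) * (1 + (v - x) ^ 2) := by
  nlinarith [sq_nonneg (v + (v - x)), sq_nonneg (v * (v - x)), sq_nonneg (2 * v - x)]

/-- A power of `√(w² + c²)`, normalised to be `1` at `w = 0`, dominates `κ ^ q (1 + w²) ^ q`
whenever its exponent `m` satisfies `m ≥ 2 q` and `m ≥ 2 κ q c²`: this is Bernoulli's
inequality. -/
theorem pow_mul_one_add_sq_le {q m : ℕ} (hq : 0 < q) (hqm : 2 * q ≤ m) {κ c : ℝ} (hκ : 0 < κ)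
    (hκ1 : κ ≤ 1) (hc : c ≠ 0) (hκc : κ * (2 * q * c ^ 2) ≤ m) (w : ℝ) :
    (κ * (1 + w ^ 2)) ^ q * |c| ^ m ≤ √(w ^ 2 + c ^ 2) ^ m := by
  have hc2 : 0 < c ^ 2 := by positivity
  have hq' : (0 : ℝ) < q := by exact_mod_cast hq
  set u := w ^ 2 / c ^ 2 with hu
  have hu0 : 0 ≤ u := by positivity
  have h1 : w ^ 2 + c ^ 2 = c ^ 2 * (1 + u) := by rw [hu]; field_simp; ring
  have h2 : √(w ^ 2 + c ^ 2) ^ m = |c| ^ m * √(1 + u) ^ m := by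
    rw [h1, Real.sqrt_mul hc2.le, Real.sqrt_sq_eq_abs, mul_pow]
  have h3 : √(1 + u) ^ m = ((1 + u) ^ ((m : ℝ) / (2 * q))) ^ q := by
    rw [Real.sqrt_eq_rpow, ← Real.rpow_natCast, ← Real.rpow_natCast,
      ← Real.rpow_mul (by positivity), ← Real.rpow_mul (by positivity)]
    congr 1
    field_simp
  have h4 : 1 + (m : ℝ) / (2 * q) * u ≤ (1 + u) ^ ((m : ℝ) / (2 * q)) := by
    refine one_add_mul_self_le_rpow_one_add (by linarith) ?_
    rw [le_div_iff₀ (by positivity)]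
    exact_mod_cast (by omega : 1 * (2 * q) ≤ m)
  have h5 : κ * w ^ 2 ≤ (m : ℝ) / (2 * q) * u := by
    rw [hu, div_mul_div_comm, le_div_iff₀ (by positivity)]
    nlinarith [mul_le_mul_of_nonneg_left hκc (sq_nonneg w)]
  rw [h2, h3, mul_comm]
  gcongr
  nlinarith

/-- The pointwise bound used for dominated convergence: the decay of the kernel in `v - x` absorbs
the polynomial growth `A ≤ C (1 + x ^ 2) ^ p` and leaves `(1 + x ^ 2)⁻¹`, at the price of a power of
`1 + v ^ 2`, which the factor `exp (-v ^ 2)` of the kernel absorbs. The constants depend on `m` only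
through `κ`. -/
theorem div_sqrt_pow_le {p m : ℕ} (hpm : 2 * (p + 1) ≤ m) {κ c C A x : ℝ} (hκ : 0 < κ)
    (hκ1 : κ ≤ 1) (hc : c ≠ 0) (hκc : κ * (2 * (p + 1 : ℕ) * c ^ 2) ≤ m)
    (hA : A ≤ C * (1 + x ^ 2) ^ p) (hC : 0 ≤ C) (v : ℝ) :
    A * (|c| / √((v - x) ^ 2 + c ^ 2)) ^ m ≤
      C * (2 / κ) ^ (p + 1) * ((1 + v ^ 2) ^ (p + 1) * (1 + x ^ 2)⁻¹) := by
  have h1 := pow_mul_one_add_sq_le (q := p + 1) p.succ_pos hpm hκ hκ1 hc hκc (v - x)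
  have hc' := abs_pos.2 hc
  have hs : 0 < √((v - x) ^ 2 + c ^ 2) := Real.sqrt_pos.2 (by positivity)
  have h2 : (|c| / √((v - x) ^ 2 + c ^ 2)) ^ m ≤ ((κ * (1 + (v - x) ^ 2)) ^ (p + 1))⁻¹ := by
    rw [div_pow, div_le_iff₀ (by positivity), inv_mul_eq_div, le_div_iff₀ (by positivity)]
    linarith
  have h3 : ((κ * (1 + (v - x) ^ 2)) ^ (p + 1))⁻¹ ≤
      (2 / κ) ^ (p + 1) * ((1 + v ^ 2) ^ (p + 1) * ((1 + x ^ 2) ^ (p + 1))⁻¹) := by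
    rw [← inv_pow, ← inv_pow, ← mul_pow, ← mul_pow]
    refine pow_le_pow_left₀ (by positivity) ?_ _
    rw [inv_le_iff_one_le_mul₀ (by positivity)]
    have := one_add_sq_le_two_mul x v
    have hx : 0 < 1 + x ^ 2 := by positivity
    have e : 2 / κ * ((1 + v ^ 2) * (1 + x ^ 2)⁻¹) * (κ * (1 + (v - x) ^ 2)) =
      2 * (1 + v ^ 2) * (1 + (v - x) ^ 2) / (1 + x ^ 2) := by field_simp
    rw [e, one_le_div hx]
    exact this
  calc A * (|c| / √((v - x) ^ 2 + c ^ 2)) ^ m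
      ≤ C * (1 + x ^ 2) ^ p * (|c| / √((v - x) ^ 2 + c ^ 2)) ^ m := by gcongr
    _ ≤ C * (1 + x ^ 2) ^ p * ((2 / κ) ^ (p + 1) *
          ((1 + v ^ 2) ^ (p + 1) * ((1 + x ^ 2) ^ (p + 1))⁻¹)) := by
        gcongr
        exact h2.trans h3
    _ = _ := by
        have hx : 0 < 1 + x ^ 2 := by positivity
        field_simp
        ring

theorem integrable_one_add_sq_pow_mul_exp (q : ℕ) :
    Integrable fun v : ℝ => (1 + v ^ 2) ^ q * Real.exp (-v ^ 2) := by
  refine (integrable_poly_mul_gaussian ((1 + Polynomial.X ^ 2) ^ q)).congr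
    (Eventually.of_forall fun x => ?_)
  simp [Polynomial.eval_pow]

/-- The function dominating all kernels in the plane. -/
theorem integrable_dominating (D : ℝ) (q : ℕ) :
    Integrable (fun z : ℝ × ℝ => D * ((1 + z.2 ^ 2) ^ q * (1 + z.1 ^ 2)⁻¹ * Real.exp (-z.2 ^ 2)))
      (volume.prod volume) := by
  have := (integrable_inv_one_add_sq.mul_prod (integrable_one_add_sq_pow_mul_exp q)).const_mul D
  refine this.congr (Eventually.of_forall fun z => ?_)
  simp only
  ring

theorem norm_line_sub_line (v h x y : ℝ) :
    ‖(v + h * Complex.I - (x + y * Complex.I) : ℂ)‖ = √((v - x) ^ 2 + (h - y) ^ 2) := by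
  have e : (v + h * Complex.I - (x + y * Complex.I) : ℂ) =
    ((v - x : ℝ) : ℂ) + ((h - y : ℝ) : ℂ) * Complex.I := by push_cast; ring
  rw [e, Complex.norm_add_mul_I]

/-! ### Moving the contour of the coefficient integrals -/

section Shift

variable {F : ℂ → ℂ} {ρ C : ℝ} {p : ℕ}

theorem continuous_line (hFd : DifferentiableOn ℂ F (strip ρ)) {y : ℝ} (hy : |y| ≤ ρ) :
    Continuous fun x : ℝ => F (x + y * Complex.I) := by
  refine hFd.continuousOn.comp_continuous (by fun_prop) fun x => ?_
  simpa [strip] using abs_le.1 hy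

theorem bound_const_nonneg (hρ : 0 < ρ)
    (hFb : ∀ x y : ℝ, |y| ≤ ρ → ‖F (x + y * Complex.I)‖ ≤ C * (1 + x ^ 2) ^ p) : 0 ≤ C := by
  have := (norm_nonneg _).trans (hFb 0 0 (by simpa using hρ.le))
  simpa using this

/-- The kernels with pole on the line `Im s = h` have a common bound on all lines `Im z = y` at
distance at least `|h|` from the pole; it is integrable in the plane against `exp (-v ^ 2)`. -/
theorem exists_norm_mul_inv_pow_le (hρ : 0 < ρ)
    (hFb : ∀ x y : ℝ, |y| ≤ ρ → ‖F (x + y * Complex.I)‖ ≤ C * (1 + x ^ 2) ^ p)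
    {n : ℕ} (hn : 2 * (p + 1) ≤ n + 1) {h : ℝ} (hh : h ≠ 0) :
    ∃ D : ℝ, ∀ y : ℝ, |y| ≤ ρ → |h| ≤ |h - y| → ∀ x v : ℝ,
      ‖F (x + y * Complex.I) / (v + h * Complex.I - (x + y * Complex.I)) ^ (n + 1)‖ ≤
        D * ((1 + v ^ 2) ^ (p + 1) * (1 + x ^ 2)⁻¹) := by
  have hC := bound_const_nonneg hρ hFb
  have hh' := abs_pos.2 hh
  set κ : ℝ := min 1 (1 / (|h| + ρ) ^ 2) with hκdef
  have hκ : 0 < κ := lt_min one_pos (by positivity)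
  refine ⟨C * (2 / κ) ^ (p + 1) / |h| ^ (n + 1), fun y hy hhy x v => ?_⟩
  have hne : h - y ≠ 0 := abs_pos.1 (hh'.trans_le hhy)
  have hsq : (h - y) ^ 2 ≤ (|h| + ρ) ^ 2 := by
    rw [← sq_abs (h - y)]
    exact pow_le_pow_left₀ (abs_nonneg _) ((abs_sub h y).trans (by linarith)) 2
  have hκc : κ * (2 * (p + 1 : ℕ) * (h - y) ^ 2) ≤ (n + 1 : ℕ) := by
    have h1 : κ * (h - y) ^ 2 ≤ 1 := by
      calc κ * (h - y) ^ 2 ≤ 1 / (|h| + ρ) ^ 2 * (|h| + ρ) ^ 2 := by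
            gcongr
            exact min_le_right _ _
        _ = 1 := by field_simp
    have h2 : ((2 * (p + 1) : ℕ) : ℝ) ≤ (n + 1 : ℕ) := by exact_mod_cast hn
    push_cast at h2 ⊢
    nlinarith
  have key := div_sqrt_pow_le hn hκ (min_le_left _ _) hne hκc (hFb x y hy) hC v
  have hs : 0 < √((v - x) ^ 2 + (h - y) ^ 2) := Real.sqrt_pos.2 (by positivity)
  rw [norm_div, norm_pow, norm_line_sub_line, div_mul_eq_mul_div, le_div_iff₀ (by positivity)]
  refine le_trans ?_ key
  rw [div_pow, div_mul_eq_mul_div, mul_div_assoc]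
  gcongr

/-- Exchanging the order of integration and moving the `x`-contour from the real line to
`Im z = b`, away from the pole on the line `Im s = h`. -/
theorem norm_integral_mul_lineKernel_le (hρ : 0 < ρ) (hFd : DifferentiableOn ℂ F (strip ρ))
    (hFb : ∀ x y : ℝ, |y| ≤ ρ → ‖F (x + y * Complex.I)‖ ≤ C * (1 + x ^ 2) ^ p)
    {n : ℕ} (hn : 2 * (p + 1) ≤ n + 1) {h b : ℝ} (hh : h ≠ 0) (hb : |b| ≤ ρ)
    (hsep : ∀ y ∈ Set.uIcc 0 b, |h| ≤ |h - y|) :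
    Integrable (fun x : ℝ => F x * lineKernel h n x) ∧
    ‖∫ x : ℝ, F x * lineKernel h n x‖ ≤ Real.exp (h ^ 2) / |h - b| ^ (n + 1) *
      ∫ z : ℝ × ℝ, ‖F (z.1 + b * Complex.I)‖ *
        (|h - b| / √((z.2 - z.1) ^ 2 + (h - b) ^ 2)) ^ (n + 1) * Real.exp (-z.2 ^ 2) := by
  obtain ⟨D, hD⟩ := exists_norm_mul_inv_pow_le hρ hFb hn hh
  have hyρ : ∀ y ∈ Set.uIcc 0 b, |y| ≤ ρ := fun y hy => by
    refine le_trans ?_ hb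
    rcases Set.mem_uIcc.1 hy with h1 | h1
    · rw [abs_of_nonneg h1.1, abs_of_nonneg (h1.1.trans h1.2)]; exact h1.2
    · rw [abs_of_nonpos h1.2, abs_of_nonpos (h1.1.trans h1.2)]; linarith [h1.1]
  have hne : ∀ y ∈ Set.uIcc 0 b, ∀ x v : ℝ,
      (v + h * Complex.I - (x + y * Complex.I) : ℂ) ≠ 0 := fun y hy x v => by
    rw [← norm_pos_iff, norm_line_sub_line]
    have : h - y ≠ 0 := abs_pos.1 ((abs_pos.2 hh).trans_le (hsep y hy))
    exact Real.sqrt_pos.2 (by positivity)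
  let Φ : ℝ → ℝ × ℝ → ℂ := fun y z => Complex.exp (-(z.2 + h * Complex.I) ^ 2) *
    (F (z.1 + y * Complex.I) / (z.2 + h * Complex.I - (z.1 + y * Complex.I)) ^ (n + 1))
  have hΦc : ∀ y ∈ Set.uIcc 0 b, Continuous (Φ y) := fun y hy => by
    have := (continuous_line hFd (hyρ y hy)).comp (continuous_fst (X := ℝ) (Y := ℝ))
    exact Continuous.mul (by fun_prop) (this.div (by fun_prop)
      fun z => pow_ne_zero _ (hne y hy _ _))
  have hΦi : ∀ y ∈ Set.uIcc 0 b, Integrable (Φ y) (volume.prod volume) := fun y hy => by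
    refine (integrable_dominating (Real.exp (h ^ 2) * D) (p + 1)).mono'
      (hΦc y hy).aestronglyMeasurable (Eventually.of_forall fun z => ?_)
    rw [norm_mul, norm_cexp_neg_sq_line]
    calc _ ≤ Real.exp (h ^ 2) * Real.exp (-z.2 ^ 2) *
          (D * ((1 + z.2 ^ 2) ^ (p + 1) * (1 + z.1 ^ 2)⁻¹)) := by
            gcongr
            exact hD y (hyρ y hy) (hsep y hy) _ _
      _ = _ := by ring
  have h0 : (0 : ℝ) ∈ Set.uIcc 0 b := Set.left_mem_uIcc
  have hb' : b ∈ Set.uIcc 0 b := Set.right_mem_uIcc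
  have hG : ∀ v : ℝ, ∀ y ∈ Set.uIcc 0 b, Integrable fun x : ℝ =>
      F (x + y * Complex.I) / (v + h * Complex.I - (x + y * Complex.I)) ^ (n + 1) := by
    intro v y hy
    refine (integrable_inv_one_add_sq.const_mul (D * (1 + v ^ 2) ^ (p + 1))).mono' ?_
      (Eventually.of_forall fun x => ?_)
    · exact ((continuous_line hFd (hyρ y hy)).div (by fun_prop)
        fun x => pow_ne_zero _ (hne y hy _ _)).aestronglyMeasurable
    · rw [mul_assoc]
      exact hD y (hyρ y hy) (hsep y hy) x v
  have hshift : ∀ v : ℝ, ∫ x : ℝ, Φ 0 (x, v) = ∫ x : ℝ, Φ b (x, v) := by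
    intro v
    have hz := integral_line_sub_line_eq_zero (a := 0) (b := b)
      (G := fun z => F z / (v + h * Complex.I - z) ^ (n + 1))
      (B := fun x => D * (1 + v ^ 2) ^ (p + 1) * (1 + x ^ 2)⁻¹)
      (by
        refine DifferentiableOn.div (hFd.mono fun z hz => ?_) (by fun_prop) fun z hz => ?_
        · exact abs_le.1 (hyρ z.im hz)
        · have := hne z.im hz z.re v
          rw [Complex.re_add_im] at this
          exact pow_ne_zero _ this)
      (Eventually.of_forall fun x y hy => by
        rw [mul_assoc]
        exact hD y (hyρ y hy) (hsep y hy) x v)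
      (by
        have h1 : Tendsto (fun x : ℝ => 1 + x ^ 2) (cocompact ℝ) atTop := by
          refine tendsto_atTop_add_const_left _ _ ?_
          have := (tendsto_pow_atTop (α := ℝ) two_ne_zero).comp
            (tendsto_norm_cocompact_atTop (E := ℝ))
          simpa [Function.comp_def] using this
        simpa using h1.inv_tendsto_atTop.const_mul (D * (1 + v ^ 2) ^ (p + 1)))
      ((hG v 0 h0).sub (hG v b hb'))
    rw [integral_sub (hG v 0 h0) (hG v b hb'), sub_eq_zero] at hz
    simp only [Φ]
    rw [integral_const_mul, integral_const_mul, hz]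
  have e1 : ∀ x : ℝ, F x * lineKernel h n x = ∫ v : ℝ, Φ 0 (x, v) := fun x => by
    rw [lineKernel, ← integral_const_mul]
    refine integral_congr_ae (Eventually.of_forall fun v => ?_)
    simp only [Φ, Complex.ofReal_zero, zero_mul, add_zero]
    ring
  refine ⟨by simp_rw [e1]; exact (hΦi 0 h0).integral_prod_left, ?_⟩
  calc ‖∫ x : ℝ, F x * lineKernel h n x‖ = ‖∫ v : ℝ, ∫ x : ℝ, Φ b (x, v)‖ := by
        simp_rw [e1, ← hshift]
        rw [integral_integral_swap (f := fun x v => Φ 0 (x, v)) (hΦi 0 h0)]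
    _ = ‖∫ z : ℝ × ℝ, Φ b z‖ := by
        rw [Measure.volume_eq_prod, integral_prod_symm _ (hΦi b hb')]
    _ ≤ ∫ z : ℝ × ℝ, ‖Φ b z‖ := norm_integral_le_integral_norm _
    _ = _ := by
        rw [← integral_const_mul]
        refine integral_congr_ae (Eventually.of_forall fun z => ?_)
        have hb0 : 0 < |h - b| := (abs_pos.2 hh).trans_le (hsep b hb')
        simp only [Φ]
        rw [norm_mul, norm_div, norm_pow, norm_line_sub_line, norm_cexp_neg_sq_line, div_pow]
        field_simp

end Shift

/-! ### Decay of the coefficients -/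

section Coeff

variable {F : ℂ → ℂ} {ρ C : ℝ} {p : ℕ}

/-- The integral of `‖F(x + i b)‖ exp (-v ^ 2) (1 + (v - x) ^ 2 / R ^ 2) ^ (-m / 2)` over the
plane, which bounds the contribution of the line `Im z = b` to a coefficient. -/
def planeIntegral (F : ℂ → ℂ) (b R : ℝ) (m : ℕ) : ℝ :=
  ∫ z : ℝ × ℝ, ‖F (z.1 + b * Complex.I)‖ *
    (R / √((z.2 - z.1) ^ 2 + R ^ 2)) ^ m * Real.exp (-z.2 ^ 2)

/-- The coefficient is an integral of `F` against the `n`-th derivative of the Gaussian. Its part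
from the pole line `Im s = -η` is moved to `Im z = ρ` and that from `Im s = η` to `Im z = -ρ`, so
that the distance to the pole grows to `η + ρ`. The number `η` is still free. -/
theorem norm_hermiteCoeff_le (hρ : 0 < ρ) (hFd : DifferentiableOn ℂ F (strip ρ))
    (hFb : ∀ x y : ℝ, |y| ≤ ρ → ‖F (x + y * Complex.I)‖ ≤ C * (1 + x ^ 2) ^ p)
    {g : ℝ → ℂ} (hg : ∀ x : ℝ, g x = (Real.exp (-x ^ 2 / 2) : ℂ) * F x)
    {n : ℕ} (hn : 2 * (p + 1) ≤ n + 1) {η : ℝ} (hη : 0 < η) :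
    ‖hermiteCoeff g n‖ ≤ n.factorial / (2 * Real.pi * √(gammaNorm n)) *
      (Real.exp (η ^ 2) / (η + ρ) ^ (n + 1)) *
        (planeIntegral F ρ (η + ρ) (n + 1) + planeIntegral F (-ρ) (η + ρ) (n + 1)) := by
  have hγ : 0 < √(gammaNorm n) := Real.sqrt_pos.2 (gammaNorm_pos n)
  obtain ⟨i1, h1⟩ := norm_integral_mul_lineKernel_le hρ hFd hFb hn (h := -η) (b := ρ)
    (neg_ne_zero.2 hη.ne') (abs_of_pos hρ).le (fun y hy => by
      rw [Set.uIcc_of_le hρ.le] at hy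
      rw [abs_neg, abs_of_pos hη, abs_of_neg (by linarith [hy.1])]
      linarith [hy.1])
  obtain ⟨i2, h2⟩ := norm_integral_mul_lineKernel_le hρ hFd hFb hn (h := η) (b := -ρ)
    hη.ne' (by rw [abs_neg, abs_of_pos hρ]) (fun y hy => by
      rw [Set.uIcc_of_ge (by linarith)] at hy
      rw [abs_of_pos hη, abs_of_pos (by linarith [hy.2])]
      linarith [hy.2])
  have a1 : |-η - ρ| = η + ρ := by rw [abs_of_neg (by linarith)]; ring
  have a2 : |η - -ρ| = η + ρ := by rw [abs_of_pos (by linarith)]; ring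
  have a3 : (-η - ρ) ^ 2 = (η + ρ) ^ 2 := by ring
  have a4 : (η - -ρ) ^ 2 = (η + ρ) ^ 2 := by ring
  rw [a1, a3, neg_sq] at h1
  rw [a2, a4] at h2
  have e : ∀ x : ℝ, g x * (hermitePsi n x : ℂ) =
      ((-1) ^ n / √(gammaNorm n) * (n.factorial / (2 * Real.pi * Complex.I)) : ℂ) *
        (F x * lineKernel (-η) n x - F x * lineKernel η n x) := fun x => by
    have hW := iteratedDeriv_weight_eq_lineKernel hη n x
    have hs : ((-1 : ℂ) ^ n) * (-1) ^ n = 1 := by rw [← mul_pow]; simp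
    have h3 : ((iteratedDeriv n weight x : ℝ) : ℂ) =
        (-1) ^ n * ((Real.exp (-x ^ 2 / 2) : ℂ) * hermitePsi n x * √(gammaNorm n)) := by
      simp only [iteratedDeriv_weight]
      rw [hermitePsi_eq, ← exp_half_mul_self]
      have : (√(gammaNorm n) : ℂ) ≠ 0 := by exact_mod_cast hγ.ne'
      push_cast
      field_simp
    have hγ' : (√(gammaNorm n) : ℂ) ≠ 0 := by exact_mod_cast hγ.ne'
    have h4 : g x * (hermitePsi n x : ℂ) = (-1) ^ n / √(gammaNorm n) * (F x *
        ((-1) ^ n * ((Real.exp (-x ^ 2 / 2) : ℂ) * hermitePsi n x * √(gammaNorm n)))) := by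
      rw [hg]
      field_simp
      linear_combination (-F x) * hermitePsi n x * hs
    rw [h4, ← h3, hW]
    ring
  rw [hermiteCoeff]
  simp_rw [e]
  rw [integral_const_mul, integral_sub i1 i2, norm_mul]
  have hc : ‖((-1) ^ n / √(gammaNorm n) * (n.factorial / (2 * Real.pi * Complex.I)) : ℂ)‖ =
      n.factorial / (2 * Real.pi * √(gammaNorm n)) := by
    simp [abs_of_pos Real.pi_pos, abs_of_pos hγ]
    field_simp
  rw [hc, mul_assoc (_ / _)]
  have hnn : 0 ≤ (n.factorial : ℝ) / (2 * Real.pi * √(gammaNorm n)) := by positivity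
  refine mul_le_mul_of_nonneg_left ?_ hnn
  rw [mul_add]
  exact (norm_sub_le _ _).trans (add_le_add h1 h2)

/-- The saddle-point scale `√(m / 2)`, where `exp (t ^ 2) / t ^ m` is smallest. -/
def saddle (m : ℕ) : ℝ := √((m : ℝ) / 2)

theorem saddle_sq (m : ℕ) : saddle m ^ 2 = m / 2 := Real.sq_sqrt (by positivity)

theorem saddle_nonneg (m : ℕ) : 0 ≤ saddle m := Real.sqrt_nonneg _

theorem tendsto_saddle : Tendsto saddle atTop atTop :=
  Real.tendsto_sqrt_atTop.comp (tendsto_natCast_atTop_atTop.atTop_div_const two_pos)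

theorem sqrt_two_mul_eq (m : ℕ) : √(2 * (m : ℝ)) = 2 * saddle m := by
  rw [Real.sqrt_eq_iff_mul_self_eq (by positivity) (by have := saddle_nonneg m; positivity)]
  nlinarith [saddle_sq m]

/-- The normalised kernels converge to the Gaussian: `(1 + w² / R²) ^ (-m / 2) → exp (-w²)` if
`R ~ √(m / 2)`. -/
theorem tendsto_kernel (ρ w : ℝ) :
    Tendsto (fun m : ℕ => ((saddle m + ρ / 2) / √(w ^ 2 + (saddle m + ρ / 2) ^ 2)) ^ m) atTop
      (𝓝 (Real.exp (-w ^ 2))) := by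
  have hR : Tendsto (fun m : ℕ => saddle m + ρ / 2) atTop atTop :=
    tendsto_atTop_add_const_right _ _ tendsto_saddle
  have hratio : Tendsto (fun m : ℕ => (m : ℝ) * (w ^ 2 / (saddle m + ρ / 2) ^ 2)) atTop
      (𝓝 (2 * w ^ 2)) := by
    have h1 : Tendsto (fun m : ℕ => 1 - ρ / 2 * (saddle m + ρ / 2)⁻¹) atTop (𝓝 1) := by
      simpa using (hR.inv_tendsto_atTop.const_mul (ρ / 2)).const_sub 1
    have h2 := (h1.pow 2).const_mul (2 * w ^ 2)
    simp only [one_pow, mul_one] at h2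
    refine h2.congr' ?_
    filter_upwards [hR.eventually_gt_atTop 0] with m hm
    have e : (m : ℝ) = 2 * saddle m ^ 2 := by rw [saddle_sq]; ring
    rw [e]
    set R := saddle m + ρ / 2 with hRdef
    rw [show saddle m = R - ρ / 2 by rw [hRdef]; ring]
    field_simp
  have hexp := Real.tendsto_one_add_pow_exp_of_tendsto hratio
  have hlim := (hexp.inv₀ (Real.exp_pos _).ne').sqrt
  have he : √(Real.exp (2 * w ^ 2))⁻¹ = Real.exp (-w ^ 2) := by
    rw [← Real.exp_neg, ← Real.exp_half]
    congr 1
    ring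
  rw [he] at hlim
  refine hlim.congr' ?_
  filter_upwards [hR.eventually_gt_atTop 0] with m hm
  set R := saddle m + ρ / 2
  have e1 : w ^ 2 + R ^ 2 = R ^ 2 * (1 + w ^ 2 / R ^ 2) := by field_simp; ring
  rw [e1, Real.sqrt_mul (by positivity), Real.sqrt_sq hm.le, ← inv_pow]
  have h3 : R / (R * √(1 + w ^ 2 / R ^ 2)) = √((1 + w ^ 2 / R ^ 2)⁻¹) := by
    rw [Real.sqrt_inv]
    field_simp
  rw [h3, Real.sqrt_eq_iff_mul_self_eq (by positivity) (by positivity), ← mul_pow,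
    Real.mul_self_sqrt (by positivity)]

theorem integral_gaussian_convolution (x : ℝ) :
    ∫ v : ℝ, Real.exp (-(v - x) ^ 2) * Real.exp (-v ^ 2) =
      √(Real.pi / 2) * Real.exp (-x ^ 2 / 2) := by
  have e : ∀ v : ℝ, Real.exp (-(v - x) ^ 2) * Real.exp (-v ^ 2) =
      Real.exp (-2 * (v - x / 2) ^ 2) * Real.exp (-x ^ 2 / 2) := fun v => by
    rw [← Real.exp_add, ← Real.exp_add]
    congr 1
    ring
  simp_rw [e]
  rw [integral_mul_const, integral_sub_right_eq_self (fun v => Real.exp (-2 * v ^ 2)),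
    integral_gaussian]

/-- Dominated convergence in the plane; the limit kernel is a convolution of two Gaussians. -/
theorem tendsto_planeIntegral (hρ : 0 < ρ) (hFd : DifferentiableOn ℂ F (strip ρ))
    (hFb : ∀ x y : ℝ, |y| ≤ ρ → ‖F (x + y * Complex.I)‖ ≤ C * (1 + x ^ 2) ^ p)
    {b : ℝ} (hb : |b| ≤ ρ) :
    Tendsto (fun m : ℕ => planeIntegral F b (saddle m + ρ / 2) m) atTop
      (𝓝 (√(Real.pi / 2) * ∫ x : ℝ, ‖F (x + b * Complex.I)‖ * Real.exp (-x ^ 2 / 2))) := by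
  have hC := bound_const_nonneg hρ hFb
  -- chosen so that `κ · 2 (p + 1) (√(m / 2) + ρ / 2)² ≤ m` for all `m ≥ 2`
  set κ : ℝ := 1 / ((p + 1 : ℕ) * (1 + ρ) ^ 2) with hκdef
  have hp1 : (1 : ℝ) ≤ (p + 1 : ℕ) := by exact_mod_cast Nat.succ_le_succ (Nat.zero_le p)
  have hκ : 0 < κ := by positivity
  have hκ1 : κ ≤ 1 := by
    rw [hκdef, div_le_one (by positivity)]
    nlinarith
  set bound : ℝ × ℝ → ℝ := fun z => C * (2 / κ) ^ (p + 1) *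
    ((1 + z.2 ^ 2) ^ (p + 1) * (1 + z.1 ^ 2)⁻¹ * Real.exp (-z.2 ^ 2)) with hbound
  have hFc : Continuous fun z : ℝ × ℝ => F (z.1 + b * Complex.I) :=
    (continuous_line hFd hb).comp (continuous_fst (X := ℝ) (Y := ℝ))
  have hle : ∀ᶠ m : ℕ in atTop, ∀ z : ℝ × ℝ, ‖F (z.1 + b * Complex.I)‖ *
      ((saddle m + ρ / 2) / √((z.2 - z.1) ^ 2 + (saddle m + ρ / 2) ^ 2)) ^ m *
        Real.exp (-z.2 ^ 2) ≤ bound z := by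
    filter_upwards [eventually_ge_atTop (2 * (p + 1))] with m hm z
    have hS1 : 1 ≤ saddle m := by
      rw [saddle, Real.one_le_sqrt]
      have : (2 : ℝ) ≤ m := by exact_mod_cast (by omega : 2 ≤ m)
      linarith
    have hR : 0 < saddle m + ρ / 2 := by linarith
    have hκc : κ * (2 * (p + 1 : ℕ) * (saddle m + ρ / 2) ^ 2) ≤ m := by
      have h1 : (saddle m + ρ / 2) ^ 2 ≤ (1 + ρ) ^ 2 * (m / 2) := by
        rw [← saddle_sq, ← mul_pow]
        refine pow_le_pow_left₀ hR.le ?_ 2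
        nlinarith
      rw [hκdef, one_div, inv_mul_le_iff₀ (by positivity)]
      nlinarith
    have := div_sqrt_pow_le hm hκ hκ1 hR.ne' hκc (hFb z.1 b hb) hC z.2
    rw [abs_of_pos hR] at this
    rw [hbound]
    simp only
    rw [← mul_assoc (C * (2 / κ) ^ (p + 1))]
    gcongr
  have hker : ∀ z : ℝ × ℝ, Tendsto (fun m : ℕ => ‖F (z.1 + b * Complex.I)‖ *
      ((saddle m + ρ / 2) / √((z.2 - z.1) ^ 2 + (saddle m + ρ / 2) ^ 2)) ^ m *
        Real.exp (-z.2 ^ 2)) atTop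
      (𝓝 (‖F (z.1 + b * Complex.I)‖ * Real.exp (-(z.2 - z.1) ^ 2) * Real.exp (-z.2 ^ 2))) :=
    fun z => ((tendsto_kernel ρ (z.2 - z.1)).const_mul _).mul_const _
  have hbi := integrable_dominating (C * (2 / κ) ^ (p + 1)) (p + 1)
  have hlim := tendsto_integral_filter_of_dominated_convergence
    (μ := (volume : Measure ℝ).prod volume) bound
    (F := fun (m : ℕ) (z : ℝ × ℝ) => ‖F (z.1 + b * Complex.I)‖ *
      ((saddle m + ρ / 2) / √((z.2 - z.1) ^ 2 + (saddle m + ρ / 2) ^ 2)) ^ m *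
        Real.exp (-z.2 ^ 2)) (l := atTop)
    (f := fun z => ‖F (z.1 + b * Complex.I)‖ * Real.exp (-(z.2 - z.1) ^ 2) * Real.exp (-z.2 ^ 2))
    (Eventually.of_forall fun m => by
      have h1 : Measurable fun z : ℝ × ℝ =>
          ((saddle m + ρ / 2) / √((z.2 - z.1) ^ 2 + (saddle m + ρ / 2) ^ 2)) ^ m := by
        fun_prop
      exact ((hFc.norm.measurable.mul h1).mul (by fun_prop)).aestronglyMeasurable)
    (by
      filter_upwards [hle, eventually_ge_atTop 0] with m hm _
      refine Eventually.of_forall fun z => ?_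
      have := saddle_nonneg m
      rw [Real.norm_of_nonneg (by positivity)]
      exact hm z)
    hbi (Eventually.of_forall hker)
  have hi : Integrable (fun z : ℝ × ℝ => ‖F (z.1 + b * Complex.I)‖ *
      Real.exp (-(z.2 - z.1) ^ 2) * Real.exp (-z.2 ^ 2)) (volume.prod volume) := by
    refine hbi.mono' ((hFc.norm.mul (by fun_prop)).mul (by fun_prop)).aestronglyMeasurable
      (Eventually.of_forall fun z => ?_)
    rw [Real.norm_of_nonneg (by positivity)]
    exact le_of_tendsto (hker z) (hle.mono fun m hm => hm z)
  rw [integral_prod _ hi] at hlim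
  simp only [mul_assoc] at hlim
  simp_rw [integral_const_mul, integral_gaussian_convolution] at hlim
  rw [← integral_const_mul]
  have e : ∀ x : ℝ, ‖F (x + b * Complex.I)‖ * (√(Real.pi / 2) * Real.exp (-x ^ 2 / 2)) =
    √(Real.pi / 2) * (‖F (x + b * Complex.I)‖ * Real.exp (-x ^ 2 / 2)) := fun x => by ring
  simp_rw [e] at hlim
  refine hlim.congr fun m => ?_
  rw [planeIntegral, Measure.volume_eq_prod]
  simp only [mul_assoc]

/-- The prefactor of the coefficient bound, multiplied by `(n + 1) ^ (1 / 4)`, in terms of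
`Stirling.stirlingSeq`, which tends to `√π`. -/
theorem prefactor_eq (n : ℕ) :
    n.factorial / (2 * Real.pi * √(gammaNorm n)) *
      (Real.exp (saddle (n + 1) ^ 2) / saddle (n + 1) ^ (n + 1)) *
        ((n : ℝ) + 1) ^ (1 / 4 : ℝ) =
    √(Stirling.stirlingSeq (n + 1) * (√2 / (2 * Real.pi ^ 2 * √Real.pi))) := by
  symm
  have hm : (0 : ℝ) < n + 1 := by positivity
  have hN : 0 < saddle (n + 1) := Real.sqrt_pos.2 (by positivity)
  have hγ : 0 < √(gammaNorm n) := Real.sqrt_pos.2 (gammaNorm_pos n)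
  have hST := Stirling.stirlingSeq'_pos n
  rw [Real.sqrt_eq_iff_mul_self_eq (by positivity) (by positivity)]
  have e1 : (((n : ℝ) + 1) ^ (1 / 4 : ℝ)) ^ 2 = √((n : ℝ) + 1) := by
    rw [← Real.rpow_natCast, ← Real.rpow_mul hm.le, Real.sqrt_eq_rpow]
    norm_num
  have e2 : Real.exp (saddle (n + 1) ^ 2) ^ 2 = Real.exp 1 ^ (n + 1) := by
    rw [← Real.exp_nat_mul, ← Real.exp_nat_mul, saddle_sq]
    congr 1
    push_cast
    ring
  have e3 : (saddle (n + 1) ^ (n + 1)) ^ 2 = (((n : ℝ) + 1) / 2) ^ (n + 1) := by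
    rw [← pow_mul, mul_comm, pow_mul, saddle_sq]
    push_cast
    rfl
  have e4 : √(gammaNorm n) ^ 2 = 2 ^ n * (n.factorial : ℝ) * √Real.pi :=
    Real.sq_sqrt (gammaNorm_pos n).le
  have e5 : √(2 * ((n : ℝ) + 1)) = √2 * √((n : ℝ) + 1) := Real.sqrt_mul (by norm_num) _
  have e6 : √((n : ℝ) + 1) * √((n : ℝ) + 1) = n + 1 := Real.mul_self_sqrt hm.le
  have hsq : ∀ a : ℝ, a * a = a ^ 2 := fun a => (sq a).symm
  rw [hsq, mul_pow, mul_pow, div_pow, div_pow, mul_pow, mul_pow, e1, e2, e3, e4]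
  rw [Stirling.stirlingSeq, Nat.factorial_succ]
  push_cast
  rw [e5]
  have h2 : 0 < √2 := by positivity
  have h3 : 0 < √((n : ℝ) + 1) := Real.sqrt_pos.2 hm
  have h4 : (0 : ℝ) < n.factorial := by exact_mod_cast n.factorial_pos
  have h5 : 0 < √Real.pi := Real.sqrt_pos.2 Real.pi_pos
  rw [div_pow, div_pow]
  field_simp
  rw [show (2 : ℝ) ^ (n + 1) = 2 * 2 ^ n by ring]
  linear_combination (-(2 : ℝ)) * 2 ^ n * e6

theorem prefactor_limit :
    √(√Real.pi * (√2 / (2 * Real.pi ^ 2 * √Real.pi))) * √(Real.pi / 2) =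
      1 / ((2 : ℝ) ^ (3 / 4 : ℝ) * √Real.pi) := by
  have h1 : ((2 : ℝ) ^ (3 / 4 : ℝ)) ^ 2 = 2 * √2 := by
    rw [← Real.rpow_natCast, ← Real.rpow_mul (by norm_num), Real.sqrt_eq_rpow]
    nth_rw 2 [← Real.rpow_one 2]
    rw [← Real.rpow_add (by norm_num)]
    norm_num
  have h2 : √Real.pi ^ 2 = Real.pi := Real.sq_sqrt Real.pi_pos.le
  have h3 : √2 * √2 = (2 : ℝ) := Real.mul_self_sqrt (by norm_num)
  have h4 : 0 < √Real.pi := Real.sqrt_pos.2 Real.pi_pos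
  have hpi := Real.pi_pos
  rw [← Real.sqrt_mul (by positivity), Real.sqrt_eq_iff_mul_self_eq (by positivity) (by positivity),
    ← sq, div_pow, mul_pow, h1, h2]
  field_simp
  linear_combination h3

/-- The choice `η = √(m / 2) - ρ / 2` produces exactly the factor `exp (-ρ √(2 m))`, with the
constant `exp (ρ ^ 2 / 2)` that turns `‖F‖ exp (-x ^ 2 / 2)` into `‖f‖` on the boundary lines. -/
theorem exp_div_pow_le (hρ : 0 < ρ) {m : ℕ} (hm : 0 < m) :
    Real.exp ((saddle m - ρ / 2) ^ 2) / (saddle m + ρ / 2) ^ m ≤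
      Real.exp (saddle m ^ 2) / saddle m ^ m *
        (Real.exp (ρ ^ 2 / 2) * Real.exp (-ρ * (2 * saddle m))) := by
  have hm' : (0 : ℝ) < m := by exact_mod_cast hm
  have hN : 0 < saddle m := Real.sqrt_pos.2 (by positivity)
  set N := saddle m with hNdef
  have hy : 0 < ρ / (2 * N) := by positivity
  -- `log (1 + y) ≥ 2 y / (2 + y) ≥ y - y² / 2`
  have hlog : ρ / (2 * N) - (ρ / (2 * N)) ^ 2 / 2 ≤ Real.log (1 + ρ / (2 * N)) := by
    refine le_trans ?_ (Real.le_log_one_add_of_nonneg hy.le)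
    rw [le_div_iff₀ (by positivity)]
    nlinarith [pow_pos hy 3]
  have h1 : Real.exp (N * ρ - ρ ^ 2 / 4) ≤ (1 + ρ / (2 * N)) ^ m := by
    have hpos : 0 < 1 + ρ / (2 * N) := by positivity
    rw [← Real.exp_log hpos, ← Real.exp_nat_mul]
    refine Real.exp_le_exp.2 ?_
    have e : (m : ℝ) = 2 * N ^ 2 := by rw [hNdef, saddle_sq]; ring
    have e2 : N * ρ - ρ ^ 2 / 4 = m * (ρ / (2 * N) - (ρ / (2 * N)) ^ 2 / 2) := by
      rw [e]; field_simp; ring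
    rw [e2]
    gcongr
  have h2 : (N + ρ / 2) ^ m = N ^ m * (1 + ρ / (2 * N)) ^ m := by
    rw [← mul_pow]
    congr 1
    field_simp
  rw [h2, div_le_iff₀ (by positivity)]
  calc Real.exp ((N - ρ / 2) ^ 2) = Real.exp (N ^ 2) * (Real.exp (ρ ^ 2 / 2) *
        Real.exp (-ρ * (2 * N))) * Real.exp (N * ρ - ρ ^ 2 / 4) := by
        rw [← Real.exp_add, ← Real.exp_add, ← Real.exp_add]
        congr 1
        ring
    _ ≤ Real.exp (N ^ 2) * (Real.exp (ρ ^ 2 / 2) * Real.exp (-ρ * (2 * N))) *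
        (1 + ρ / (2 * N)) ^ m := by gcongr
    _ = _ := by
        have : N ^ m ≠ 0 := by positivity
        field_simp

/-- The coefficient asymptotics, in terms of the integral of `‖F‖ exp (-x ^ 2 / 2)` over the
boundary of the strip. -/
theorem exists_coeff_bound (hρ : 0 < ρ) (hFd : DifferentiableOn ℂ F (strip ρ))
    (hFb : ∀ x y : ℝ, |y| ≤ ρ → ‖F (x + y * Complex.I)‖ ≤ C * (1 + x ^ 2) ^ p)
    {g : ℝ → ℂ} (hg : ∀ x : ℝ, g x = (Real.exp (-x ^ 2 / 2) : ℂ) * F x) :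
    ∃ K : ℕ → ℝ, Tendsto K atTop (𝓝 (Real.exp (ρ ^ 2 / 2) *
        ((∫ x : ℝ, ‖F (x + ρ * Complex.I)‖ * Real.exp (-x ^ 2 / 2)) +
          ∫ x : ℝ, ‖F (x + (-ρ : ℝ) * Complex.I)‖ * Real.exp (-x ^ 2 / 2)) /
        ((2 : ℝ) ^ (3 / 4 : ℝ) * √Real.pi))) ∧
      ∀ᶠ n : ℕ in atTop, ‖hermiteCoeff g n‖ ≤ K n *
        (Real.exp (-ρ * √(2 * ((n : ℝ) + 1))) / ((n : ℝ) + 1) ^ (1 / 4 : ℝ)) := by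
  refine ⟨fun n => √(Stirling.stirlingSeq (n + 1) * (√2 / (2 * Real.pi ^ 2 * √Real.pi))) *
    Real.exp (ρ ^ 2 / 2) * (planeIntegral F ρ (saddle (n + 1) + ρ / 2) (n + 1) +
      planeIntegral F (-ρ) (saddle (n + 1) + ρ / 2) (n + 1)), ?_, ?_⟩
  · have h1 := (tendsto_planeIntegral hρ hFd hFb (b := ρ) (abs_of_pos hρ).le).comp
      (tendsto_add_atTop_nat 1)
    have h2 := (tendsto_planeIntegral hρ hFd hFb (b := -ρ)
      (by rw [abs_neg, abs_of_pos hρ])).comp (tendsto_add_atTop_nat 1)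
    have h3 := ((Stirling.tendsto_stirlingSeq_sqrt_pi.comp (tendsto_add_atTop_nat 1)).mul_const
      (√2 / (2 * Real.pi ^ 2 * √Real.pi))).sqrt
    have h4 := (h3.mul_const (Real.exp (ρ ^ 2 / 2))).mul (h1.add h2)
    have hlim : ∀ a b : ℝ, √(√Real.pi * (√2 / (2 * Real.pi ^ 2 * √Real.pi))) *
        Real.exp (ρ ^ 2 / 2) * (√(Real.pi / 2) * a + √(Real.pi / 2) * b) =
        Real.exp (ρ ^ 2 / 2) * (a + b) / ((2 : ℝ) ^ (3 / 4 : ℝ) * √Real.pi) := fun a b => by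
      rw [div_eq_mul_one_div _ ((2 : ℝ) ^ (3 / 4 : ℝ) * √Real.pi), ← prefactor_limit]
      ring
    rw [hlim] at h4
    exact h4
  · have hη : ∀ᶠ n : ℕ in atTop, ρ / 2 < saddle (n + 1) :=
      (tendsto_saddle.comp (tendsto_add_atTop_nat 1)).eventually_gt_atTop _
    filter_upwards [eventually_ge_atTop (2 * (p + 1)), hη] with n hn hηn
    have key := norm_hermiteCoeff_le hρ hFd hFb hg (n := n) (by omega)
      (η := saddle (n + 1) - ρ / 2) (by linarith)
    rw [show saddle (n + 1) - ρ / 2 + ρ = saddle (n + 1) + ρ / 2 by ring] at key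
    have hP : ∀ b, 0 ≤ planeIntegral F b (saddle (n + 1) + ρ / 2) (n + 1) := fun b =>
      integral_nonneg fun z => by
        have := saddle_nonneg (n + 1)
        positivity
    have hP' := add_nonneg (hP ρ) (hP (-ρ))
    have hγ : 0 < √(gammaNorm n) := Real.sqrt_pos.2 (gammaNorm_pos n)
    have h1 := exp_div_pow_le hρ n.succ_pos
    have hm : (0 : ℝ) < (n : ℝ) + 1 := by positivity
    refine key.trans ?_
    rw [← prefactor_eq]
    have e := sqrt_two_mul_eq (n + 1)
    push_cast at e
    rw [e]
    have hq : (0 : ℝ) < ((n : ℝ) + 1) ^ (1 / 4 : ℝ) := by positivity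
    calc _ ≤ n.factorial / (2 * Real.pi * √(gammaNorm n)) *
          (Real.exp (saddle (n + 1) ^ 2) / saddle (n + 1) ^ (n + 1) *
            (Real.exp (ρ ^ 2 / 2) * Real.exp (-ρ * (2 * saddle (n + 1))))) *
          (planeIntegral F ρ (saddle (n + 1) + ρ / 2) (n + 1) +
            planeIntegral F (-ρ) (saddle (n + 1) + ρ / 2) (n + 1)) := by gcongr
      _ = _ := by
          field_simp

end Coeff

/-! ### Tails of the Hermite expansion -/

/-- The rate `exp (-ρ √(2 (n + 1))) / (n + 1) ^ (1 / 4)` of the `n`-th coefficient. -/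
def coeffRate (ρ : ℝ) (n : ℕ) : ℝ :=
  Real.exp (-ρ * √(2 * ((n : ℝ) + 1))) / ((n : ℝ) + 1) ^ (1 / 4 : ℝ)

theorem coeffRate_pos (ρ : ℝ) (n : ℕ) : 0 < coeffRate ρ n := by
  unfold coeffRate; positivity

/-- The square of the rate is bounded by a telescoping difference, because
`√(k + 1) - √k ≥ 1 / (2 √(k + 1))`. -/
theorem coeffRate_sq_le {ρ : ℝ} (hρ : 0 < ρ) (k : ℕ) :
    coeffRate ρ k ^ 2 ≤ Real.exp (-(2 * ρ) * √(2 * (k : ℝ))) / (√2 * ρ) -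
      Real.exp (-(2 * ρ) * √(2 * ((k + 1 : ℕ) : ℝ))) / (√2 * ρ) := by
  have hk : (0 : ℝ) < (k : ℝ) + 1 := by positivity
  have h2 : 0 < √2 := by positivity
  set s := √((k : ℝ) + 1) with hs
  set t := √(k : ℝ) with ht
  have hs0 : 0 < s := Real.sqrt_pos.2 hk
  have ht0 : 0 ≤ t := Real.sqrt_nonneg _
  have hss : s ^ 2 = k + 1 := Real.sq_sqrt hk.le
  have htt : t ^ 2 = k := Real.sq_sqrt (by positivity)
  have e1 : √(2 * ((k : ℝ) + 1)) = √2 * s := Real.sqrt_mul (by norm_num) _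
  have e2 : √(2 * (k : ℝ)) = √2 * t := Real.sqrt_mul (by norm_num) _
  have e3 : (((k : ℝ) + 1) ^ (1 / 4 : ℝ)) ^ 2 = s := by
    rw [← Real.rpow_natCast, ← Real.rpow_mul hk.le, hs, Real.sqrt_eq_rpow]
    norm_num
  have hdiff : 1 / (2 * s) ≤ s - t := by
    rw [div_le_iff₀ (by positivity)]
    nlinarith [sq_nonneg (s - t)]
  have hexp : Real.exp (-(2 * ρ) * (√2 * s)) * (1 + 2 * ρ * √2 * (s - t)) ≤
      Real.exp (-(2 * ρ) * (√2 * t)) := by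
    have := Real.add_one_le_exp (2 * ρ * √2 * (s - t))
    calc _ ≤ Real.exp (-(2 * ρ) * (√2 * s)) * Real.exp (2 * ρ * √2 * (s - t)) := by
          gcongr
          linarith
      _ = _ := by rw [← Real.exp_add]; congr 1; ring
  push_cast
  rw [coeffRate, div_pow, e1, e2, e3, ← Real.exp_nat_mul, ← sub_div, le_div_iff₀ (by positivity)]
  have e4 : ((2 : ℕ) : ℝ) * (-ρ * (√2 * s)) = -(2 * ρ) * (√2 * s) := by push_cast; ring
  rw [e4]
  have h3 : Real.exp (-(2 * ρ) * (√2 * s)) / s * (√2 * ρ) ≤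
      Real.exp (-(2 * ρ) * (√2 * s)) * (2 * ρ * √2 * (s - t)) := by
    calc _ = Real.exp (-(2 * ρ) * (√2 * s)) * (2 * ρ * √2 * (1 / (2 * s))) := by
          field_simp
      _ ≤ _ := by gcongr
  linarith

theorem sum_coeffRate_sq_le {ρ : ℝ} (hρ : 0 < ρ) (n N : ℕ) :
    ∑ k ∈ Finset.Ico n N, coeffRate ρ k ^ 2 ≤
      Real.exp (-(2 * ρ) * √(2 * (n : ℝ))) / (√2 * ρ) := by
  rcases le_total n N with h | h
  · calc _ ≤ ∑ k ∈ Finset.Ico n N, (Real.exp (-(2 * ρ) * √(2 * (k : ℝ))) / (√2 * ρ) -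
          Real.exp (-(2 * ρ) * √(2 * ((k + 1 : ℕ) : ℝ))) / (√2 * ρ)) :=
          Finset.sum_le_sum fun k _ => coeffRate_sq_le hρ k
      _ = Real.exp (-(2 * ρ) * √(2 * (n : ℝ))) / (√2 * ρ) -
          Real.exp (-(2 * ρ) * √(2 * (N : ℝ))) / (√2 * ρ) := by
          rw [Finset.sum_Ico_eq_sum_range]
          have := Finset.sum_range_sub' (fun k : ℕ =>
            Real.exp (-(2 * ρ) * √(2 * ((n + k : ℕ) : ℝ))) / (√2 * ρ)) (N - n)
          rw [Nat.add_sub_cancel' h] at this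
          exact this
      _ ≤ _ := by
          have : 0 ≤ Real.exp (-(2 * ρ) * √(2 * (N : ℝ))) / (√2 * ρ) := by positivity
          linarith
  · rw [Finset.Ico_eq_empty_of_le h, Finset.sum_empty]
    positivity

theorem hermiteProj_sub {g : ℝ → ℂ} (hg : MemLp g 2 volume) {n N : ℕ} (h : n ≤ N) :
    hermiteProj N (hg.toLp g) - hermiteProj n (hg.toLp g) =
      ∑ k ∈ Finset.Ico (n + 1) (N + 1), hermiteCoeff g k • psiLp k := by
  rw [hermiteProj_toLp, hermiteProj_toLp, Finset.sum_Ico_eq_sub _ (by omega)]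

theorem norm_sum_smul_psiLp_sq (c : ℕ → ℂ) (s : Finset ℕ) :
    ‖∑ k ∈ s, c k • psiLp k‖ ^ 2 = ∑ k ∈ s, ‖c k‖ ^ 2 := by
  rw [← Complex.ofReal_inj]
  push_cast
  have h1 := inner_self_eq_norm_sq_to_K (𝕜 := ℂ) (∑ k ∈ s, c k • psiLp k)
  have h2 := orthonormal_psiLp.inner_sum c c s
  rw [h1] at h2
  refine h2.trans (Finset.sum_congr rfl fun k _ => ?_)
  rw [mul_comm, Complex.mul_conj, Complex.normSq_eq_norm_sq]
  push_cast
  rfl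

theorem norm_sub_hermiteProj_le {g : ℝ → ℂ} (hg : MemLp g 2 volume) {n : ℕ} {B : ℝ} (hB : 0 ≤ B)
    (h : ∀ N, ∑ k ∈ Finset.Ico (n + 1) N, ‖hermiteCoeff g k‖ ^ 2 ≤ B ^ 2) :
    ‖hg.toLp g - hermiteProj n (hg.toLp g)‖ ≤ B := by
  refine le_of_tendsto ((tendsto_hermiteProj (hg.toLp g)).sub_const _).norm ?_
  filter_upwards [eventually_ge_atTop n] with N hN
  rw [hermiteProj_sub hg hN]
  refine abs_le_of_sq_le_sq' ?_ hB |>.2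
  rw [norm_sum_smul_psiLp_sq]
  exact h (N + 1)

theorem eLpNorm_sub_hermiteProj {g : ℝ → ℂ} (hg : MemLp g 2 volume) (n : ℕ) :
    eLpNorm (fun x : ℝ => g x - hermiteProj n (hg.toLp g) x) 2 volume =
      ENNReal.ofReal ‖hg.toLp g - hermiteProj n (hg.toLp g)‖ := by
  rw [Lp.norm_def, ENNReal.ofReal_toReal (Lp.eLpNorm_ne_top _)]
  refine eLpNorm_congr_ae ?_
  filter_upwards [Lp.coeFn_sub (hg.toLp g) (hermiteProj n (hg.toLp g)), hg.coeFn_toLp] with x h1 h2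
  rw [h1, Pi.sub_apply, h2]

/-- A sequence whose upper limit is at most `L` is bounded by a sequence converging to `L`. -/
theorem exists_tendsto_of_eventually_le {r : ℕ → ℝ} {L : ℝ}
    (h : ∀ δ > 0, ∀ᶠ n in atTop, r n ≤ L + δ) :
    ∃ K : ℕ → ℝ, Tendsto K atTop (𝓝 L) ∧ ∀ n, r n ≤ K n := by
  refine ⟨fun n => max L (r n), ?_, fun n => le_max_right _ _⟩
  rw [Metric.tendsto_nhds]
  intro ε hε
  filter_upwards [h (ε / 2) (by linarith)] with n hn
  rw [Real.dist_eq, abs_of_nonneg (by linarith [le_max_left L (r n)])]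
  have : max L (r n) ≤ L + ε / 2 := max_le (by linarith) hn
  linarith

/-- By Parseval the error is the tail of the squared coefficients, which telescopes. -/
theorem exists_l2_bound {g : ℝ → ℂ} (hg : MemLp g 2 volume) {ρ κ : ℝ} (hρ : 0 < ρ) (hκ : 0 ≤ κ)
    (h : ∀ δ > 0, ∀ᶠ n in atTop, ‖hermiteCoeff g n‖ ≤ (κ + δ) * coeffRate ρ n) :
    ∃ K : ℕ → ℝ, Tendsto K atTop (𝓝 (κ / √(√2 * ρ))) ∧
      ∀ n : ℕ, ‖hg.toLp g - hermiteProj n (hg.toLp g)‖ ≤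
        K n * Real.exp (-ρ * √(2 * (n : ℝ))) := by
  have hs : 0 < √(√2 * ρ) := Real.sqrt_pos.2 (by positivity)
  obtain ⟨K, hK, hle⟩ := exists_tendsto_of_eventually_le (L := κ / √(√2 * ρ))
    (r := fun n : ℕ => ‖hg.toLp g - hermiteProj n (hg.toLp g)‖ * Real.exp (ρ * √(2 * (n : ℝ))))
    (by
      intro δ hδ
      obtain ⟨n₀, hn₀⟩ := eventually_atTop.1 (h (δ * √(√2 * ρ)) (by positivity))
      filter_upwards [eventually_ge_atTop n₀] with n hn
      set A := κ + δ * √(√2 * ρ) with hA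
      have hA0 : 0 ≤ A := by positivity
      have key := norm_sub_hermiteProj_le hg (n := n)
        (B := A / √(√2 * ρ) * Real.exp (-ρ * √(2 * (n : ℝ)))) (by positivity) (fun N => by
          calc _ ≤ ∑ k ∈ Finset.Ico (n + 1) N, A ^ 2 * coeffRate ρ k ^ 2 := by
                refine Finset.sum_le_sum fun k hk => ?_
                rw [← mul_pow]
                have := hn₀ k (by have := (Finset.mem_Ico.1 hk).1; omega)
                gcongr
            _ ≤ A ^ 2 * (Real.exp (-(2 * ρ) * √(2 * ((n + 1 : ℕ) : ℝ))) / (√2 * ρ)) := by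
                rw [← Finset.mul_sum]
                gcongr
                exact sum_coeffRate_sq_le hρ _ _
            _ ≤ A ^ 2 * (Real.exp (-(2 * ρ) * √(2 * (n : ℝ))) / (√2 * ρ)) := by
                have : √(2 * (n : ℝ)) ≤ √(2 * ((n + 1 : ℕ) : ℝ)) := by
                  apply Real.sqrt_le_sqrt
                  push_cast
                  linarith
                gcongr A ^ 2 * (Real.exp ?_ / _)
                nlinarith
            _ = _ := by
                rw [mul_pow, div_pow, Real.sq_sqrt (by positivity), ← Real.exp_nat_mul]
                rw [show ((2 : ℕ) : ℝ) * (-ρ * √(2 * (n : ℝ))) = -(2 * ρ) * √(2 * (n : ℝ)) by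
                  push_cast; ring]
                ring)
      calc _ ≤ A / √(√2 * ρ) * Real.exp (-ρ * √(2 * (n : ℝ))) * Real.exp (ρ * √(2 * (n : ℝ))) := by
            gcongr
        _ = A / √(√2 * ρ) := by
            rw [mul_assoc, ← Real.exp_add]
            simp
        _ = _ := by rw [hA]; field_simp)
  refine ⟨K, hK, fun n => ?_⟩
  have := mul_le_mul_of_nonneg_right (hle n) (Real.exp_pos (-ρ * √(2 * (n : ℝ)))).le
  rw [mul_assoc, ← Real.exp_add] at this
  simpa using this

/-! ### Uniform bounds for the tails -/

/-- The partial sums converge to `g` in `L²`, so a subsequence converges almost everywhere, and the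
bound on the partial sums passes to the limit. -/
theorem norm_sub_hermiteProj_apply_le {g : ℝ → ℂ} (hg : MemLp g 2 volume) {n : ℕ} {B : ℝ}
    (h : ∀ (x : ℝ) (N : ℕ), ∑ k ∈ Finset.Ico (n + 1) N, ‖hermiteCoeff g k‖ * |hermitePsi k x| ≤ B) :
    ∀ᵐ x : ℝ, ‖g x - hermiteProj n (hg.toLp g) x‖ ≤ B := by
  obtain ⟨φ, hφ, hlim⟩ := (tendstoInMeasure_of_tendsto_Lp
    (tendsto_hermiteProj (hg.toLp g))).exists_seq_tendsto_ae
  have hproj : ∀ᵐ x : ℝ, ∀ N : ℕ, hermiteProj N (hg.toLp g) x =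
      ∑ k ∈ Finset.range (N + 1), hermiteCoeff g k * (hermitePsi k x : ℂ) := by
    rw [ae_all_iff]
    intro N
    rw [hermiteProj_toLp]
    exact sum_smul_psiLp_ae _ _
  filter_upwards [hlim, hproj, hg.coeFn_toLp] with x h1 h2 h3
  rw [h3] at h1
  refine le_of_tendsto (h1.sub_const _).norm ?_
  filter_upwards [hφ.tendsto_atTop.eventually_ge_atTop n] with j hj
  rw [h2, h2, ← Finset.sum_Ico_eq_sub _ (by omega)]
  refine (norm_sum_le _ _).trans ((Finset.sum_le_sum fun k _ => ?_).trans (h x (φ j + 1)))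
  rw [norm_mul, Complex.norm_real, Real.norm_eq_abs]

theorem summable_one_add_mul_exp {c : ℝ} (hc : 0 < c) :
    Summable fun j : ℕ => (1 + (j : ℝ)) * Real.exp (-c * j) := by
  have h1 : ‖Real.exp (-c)‖ < 1 := by
    rw [Real.norm_of_nonneg (Real.exp_pos _).le, Real.exp_lt_one_iff]
    linarith
  have h2 := (summable_pow_mul_geometric_of_norm_lt_one 1 h1).add
    (summable_geometric_of_norm_lt_one h1)
  refine h2.congr fun j => ?_
  rw [← Real.exp_nat_mul]
  rw [pow_one, mul_comm (j : ℝ) (-c)]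
  ring

/-- Summing over the blocks `m² ≤ k ≤ m² + 2 m`: if on each block the squares of the Hermite
functions add up to at most `δ m`, then Cauchy–Schwarz on each block and the exponential decay from
block to block bound the tail of the expansion. -/
theorem sum_coeff_mul_psi_le {g : ℝ → ℂ} {ρ D : ℝ} (hρ : 0 < ρ) (hD : 0 ≤ D)
    (hc : ∀ k, ‖hermiteCoeff g k‖ ≤ D * coeffRate ρ k) {δ : ℝ} (hδ : 0 ≤ δ) {n : ℕ} (hn : 1 ≤ n)
    (hblock : ∀ m : ℕ, Nat.sqrt n ≤ m → ∀ x : ℝ,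
      ∑ k ∈ Finset.Icc (m ^ 2) (m ^ 2 + 2 * m), hermitePsi k x ^ 2 ≤ δ * m) (x : ℝ) (N : ℕ) :
    ∑ k ∈ Finset.Ico (n + 1) N, ‖hermiteCoeff g k‖ * |hermitePsi k x| ≤
      D / √(√2 * ρ) * Real.exp (√2 * ρ) * (∑' j : ℕ, (1 + (j : ℝ)) * Real.exp (-(√2 * ρ) * j)) *
        √δ * ((n : ℝ) ^ (1 / 4 : ℝ) * Real.exp (-ρ * √(2 * (n : ℝ)))) := by
  set c := √2 * ρ with hcdef
  have hc0 : 0 < c := by positivity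
  set m₀ := Nat.sqrt n with hm₀
  have hm₀1 : 1 ≤ m₀ := Nat.le_sqrt.2 (by simpa using hn)
  have hm₀R : (1 : ℝ) ≤ m₀ := by exact_mod_cast hm₀1
  -- one block
  have hone : ∀ m : ℕ, m₀ ≤ m →
      ∑ k ∈ Finset.Icc (m ^ 2) (m ^ 2 + 2 * m), ‖hermiteCoeff g k‖ * |hermitePsi k x| ≤
        D / √c * √δ * (√m * Real.exp (-c * m)) := by
    intro m hm
    have h1 : ∑ k ∈ Finset.Icc (m ^ 2) (m ^ 2 + 2 * m), ‖hermiteCoeff g k‖ ^ 2 ≤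
        (D / √c * Real.exp (-c * m)) ^ 2 := by
      calc _ ≤ ∑ k ∈ Finset.Icc (m ^ 2) (m ^ 2 + 2 * m), D ^ 2 * coeffRate ρ k ^ 2 := by
            refine Finset.sum_le_sum fun k _ => ?_
            rw [← mul_pow]
            have := hc k
            gcongr
        _ ≤ D ^ 2 * (Real.exp (-(2 * ρ) * √(2 * ((m ^ 2 : ℕ) : ℝ))) / (√2 * ρ)) := by
            rw [← Finset.mul_sum]
            gcongr
            exact sum_coeffRate_sq_le hρ (m ^ 2) (m ^ 2 + 2 * m + 1)
        _ = _ := by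
            push_cast
            rw [Real.sqrt_mul (by norm_num), Real.sqrt_sq (by positivity), mul_pow, div_pow,
              Real.sq_sqrt hc0.le, ← Real.exp_nat_mul, hcdef]
            rw [show ((2 : ℕ) : ℝ) * (-(√2 * ρ) * m) = -(2 * ρ) * (√2 * m) by push_cast; ring]
            ring
    have h2 : ∑ k ∈ Finset.Icc (m ^ 2) (m ^ 2 + 2 * m), |hermitePsi k x| ^ 2 ≤ (√δ * √m) ^ 2 := by
      simp_rw [sq_abs]
      rw [mul_pow, Real.sq_sqrt hδ, Real.sq_sqrt (by positivity)]
      exact hblock m hm x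
    calc _ ≤ √(∑ k ∈ Finset.Icc (m ^ 2) (m ^ 2 + 2 * m), ‖hermiteCoeff g k‖ ^ 2) *
          √(∑ k ∈ Finset.Icc (m ^ 2) (m ^ 2 + 2 * m), |hermitePsi k x| ^ 2) :=
          Real.sum_mul_le_sqrt_mul_sqrt _ _ _
      _ ≤ (D / √c * Real.exp (-c * m)) * (√δ * √m) := by
          gcongr
          · exact Real.sqrt_le_iff.2 ⟨by positivity, h1⟩
          · exact Real.sqrt_le_iff.2 ⟨by positivity, h2⟩
      _ = _ := by ring
  -- splitting into blocks
  have hsplit : ∑ k ∈ Finset.Ico (n + 1) N, ‖hermiteCoeff g k‖ * |hermitePsi k x| ≤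
      ∑ m ∈ Finset.Ico m₀ (m₀ + N), D / √c * √δ * (√m * Real.exp (-c * m)) := by
    rw [← Finset.sum_fiberwise_of_maps_to (g := Nat.sqrt) (t := Finset.Ico m₀ (m₀ + N))]
    · refine Finset.sum_le_sum fun m hm => ?_
      refine le_trans ?_ (hone m (Finset.mem_Ico.1 hm).1)
      refine Finset.sum_le_sum_of_subset_of_nonneg (fun k hk => ?_) fun _ _ _ => by positivity
      have hk' := (Finset.mem_filter.1 hk).2
      rw [Finset.mem_Icc, ← hk']
      exact ⟨Nat.sqrt_le' k, by have := Nat.sqrt_le_add k; nlinarith⟩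
    · intro k hk
      rw [Finset.mem_Ico] at hk ⊢
      refine ⟨Nat.sqrt_le_sqrt (by omega), ?_⟩
      have := Nat.sqrt_le_self k
      omega
  -- `√(m₀ + j) ≤ √m₀ (1 + j)` separates the first block from the decay of the later ones
  have hterm : ∀ j : ℕ, √((m₀ + j : ℕ) : ℝ) * Real.exp (-c * ((m₀ + j : ℕ) : ℝ)) ≤
      √m₀ * Real.exp (-c * m₀) * ((1 + (j : ℝ)) * Real.exp (-c * j)) := by
    intro j
    have h1 : √((m₀ + j : ℕ) : ℝ) ≤ √m₀ * (1 + j) := by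
      rw [Real.sqrt_le_left (by positivity), mul_pow, Real.sq_sqrt (by positivity)]
      push_cast
      have hj : (0 : ℝ) ≤ j := by positivity
      nlinarith [mul_le_mul_of_nonneg_right hm₀R hj, mul_nonneg hj hj,
        mul_nonneg (by linarith : (0 : ℝ) ≤ m₀) (mul_nonneg hj hj)]
    calc _ ≤ √m₀ * (1 + j) * Real.exp (-c * ((m₀ + j : ℕ) : ℝ)) := by gcongr
      _ = _ := by
          push_cast
          rw [mul_add (-c), Real.exp_add]
          ring
  have hsum := summable_one_add_mul_exp hc0
  set S := ∑' j : ℕ, (1 + (j : ℝ)) * Real.exp (-c * j) with hS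
  have hS0 : 0 ≤ S := tsum_nonneg fun j => by positivity
  have hblocks : ∑ m ∈ Finset.Ico m₀ (m₀ + N), √m * Real.exp (-c * m) ≤
      √m₀ * Real.exp (-c * m₀) * S := by
    rw [Finset.sum_Ico_eq_sum_range, Nat.add_sub_cancel_left]
    calc _ ≤ ∑ j ∈ Finset.range N, √m₀ * Real.exp (-c * m₀) *
          ((1 + (j : ℝ)) * Real.exp (-c * j)) := Finset.sum_le_sum fun j _ => hterm j
      _ ≤ _ := by
          rw [← Finset.mul_sum]
          gcongr
          exact hsum.sum_le_tsum _ fun j _ => by positivity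
  have hn0 : (0 : ℝ) ≤ n := by positivity
  have hm₀n : (m₀ : ℝ) ≤ √n := by
    rw [Real.le_sqrt (by positivity) hn0]
    exact_mod_cast Nat.sqrt_le' n
  have hnm₀ : √(n : ℝ) ≤ m₀ + 1 := by
    rw [Real.sqrt_le_left (by positivity)]
    exact_mod_cast (Nat.lt_succ_sqrt' n).le
  have hroot : √(m₀ : ℝ) ≤ (n : ℝ) ^ (1 / 4 : ℝ) := by
    have : (n : ℝ) ^ (1 / 4 : ℝ) = √(√n) := by
      rw [Real.sqrt_eq_rpow, Real.sqrt_eq_rpow, ← Real.rpow_mul hn0]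
      norm_num
    rw [this]
    exact Real.sqrt_le_sqrt hm₀n
  have hexp : Real.exp (-c * m₀) ≤ Real.exp c * Real.exp (-ρ * √(2 * (n : ℝ))) := by
    rw [← Real.exp_add, Real.sqrt_mul (by norm_num)]
    refine Real.exp_le_exp.2 ?_
    have := mul_le_mul_of_nonneg_left hnm₀ hc0.le
    rw [hcdef] at this ⊢
    linarith
  calc _ ≤ _ := hsplit
    _ = D / √c * √δ * ∑ m ∈ Finset.Ico m₀ (m₀ + N), √m * Real.exp (-c * m) := by
        rw [Finset.mul_sum]
    _ ≤ D / √c * √δ * ((n : ℝ) ^ (1 / 4 : ℝ) *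
          (Real.exp c * Real.exp (-ρ * √(2 * (n : ℝ)))) * S) := by
        refine mul_le_mul_of_nonneg_left (hblocks.trans ?_) (by positivity)
        gcongr
    _ = _ := by ring

/-! ### Sums of squares of Hermite functions -/

theorem iteratedDeriv_cexp_neg_sq (n : ℕ) :
    iteratedDeriv n (fun s : ℂ => Complex.exp (-s ^ 2)) = fun s =>
      (-1) ^ n * (((hermitePoly n).map (algebraMap ℝ ℂ)).eval s * Complex.exp (-s ^ 2)) := by
  induction n with
  | zero => funext s; simp [hermitePoly]
  | succ n ih =>
    funext s
    have hE : HasDerivAt (fun s : ℂ => Complex.exp (-s ^ 2))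
        (Complex.exp (-s ^ 2) * (-(2 * s))) s := by
      have h0 : HasDerivAt (fun y : ℂ => -y ^ 2) (-(2 * s)) s := by
        simpa using (hasDerivAt_pow 2 s).fun_neg
      exact h0.cexp
    have hP := ((hermitePoly n).map (algebraMap ℝ ℂ)).hasDerivAt s
    rw [iteratedDeriv_succ, ih, ((hP.fun_mul hE).const_mul _).deriv]
    rw [hermitePoly, Polynomial.map_sub, Polynomial.map_mul, Polynomial.map_mul, Polynomial.map_C,
      Polynomial.map_X, ← Polynomial.derivative_map, Polynomial.eval_sub, Polynomial.eval_mul,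
      Polynomial.eval_mul, Polynomial.eval_C, Polynomial.eval_X]
    simp only [map_ofNat]
    ring

/-- The generating function of the Hermite polynomials. -/
theorem hasSum_hermitePoly_generating (x : ℝ) (w : ℂ) :
    HasSum (fun n : ℕ => (((hermitePoly n).eval x : ℝ) : ℂ) / n.factorial * w ^ n)
      (Complex.exp (2 * x * w - w ^ 2)) := by
  have hd : Differentiable ℂ fun w : ℂ => Complex.exp (-(x - w) ^ 2) := by fun_prop
  have h := (Complex.hasSum_taylorSeries_of_entire hd 0 w).mul_left (Complex.exp (x ^ 2))
  have hcoef : ∀ n : ℕ, iteratedDeriv n (fun w : ℂ => Complex.exp (-(x - w) ^ 2)) 0 =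
      (((hermitePoly n).eval x : ℝ) : ℂ) * Complex.exp (-x ^ 2) := fun n => by
    have h1 := congrFun (iteratedDeriv_comp_const_sub (𝕜 := ℂ) n
      (fun s : ℂ => Complex.exp (-s ^ 2)) (x : ℂ)) 0
    rw [h1, iteratedDeriv_cexp_neg_sq]
    have h2 : ((-1 : ℂ) ^ n) * (-1) ^ n = 1 := by rw [← mul_pow]; simp
    have h3 : ((hermitePoly n).map (algebraMap ℝ ℂ)).eval (x : ℂ) =
        ((hermitePoly n).eval x : ℝ) := by
      rw [Polynomial.eval_map_algebraMap]
      exact Polynomial.aeval_algebraMap_apply_eq_algebraMap_eval x (hermitePoly n)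
    simp only [sub_zero, smul_eq_mul]
    rw [h3]
    linear_combination ((hermitePoly n).eval x : ℝ) * Complex.exp (-x ^ 2) * h2
  have hone : Complex.exp (x ^ 2) * Complex.exp (-x ^ 2) = 1 := by
    rw [← Complex.exp_add]; simp
  rw [← Complex.exp_add] at h
  have e : (x : ℂ) ^ 2 + -(x - w) ^ 2 = 2 * x * w - w ^ 2 := by ring
  rw [e] at h
  convert! h using 1
  funext n
  rw [hcoef, sub_zero, smul_eq_mul, smul_eq_mul]
  linear_combination (-(((hermitePoly n).eval x : ℝ) : ℂ) / n.factorial * w ^ n) * hone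

theorem integral_cexp_int_mul (d : ℤ) :
    ∫ θ in (-Real.pi)..Real.pi, Complex.exp (d * θ * Complex.I) =
      if d = 0 then (2 * Real.pi : ℂ) else 0 := by
  split_ifs with h
  · subst h
    simp
    ring
  · have hc : (d * Complex.I : ℂ) ≠ 0 := mul_ne_zero (by exact_mod_cast h) Complex.I_ne_zero
    have e : ∀ θ : ℝ, Complex.exp (d * θ * Complex.I) = Complex.exp ((d * Complex.I) * θ) :=
      fun θ => by congr 1; ring
    simp_rw [e]
    rw [integral_exp_mul_complex hc]
    have h1 : (d * Complex.I : ℂ) * (Real.pi : ℝ) =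
        (d * Complex.I) * ((-Real.pi : ℝ) : ℂ) + d * (2 * Real.pi * Complex.I) := by
      push_cast; ring
    rw [h1, Complex.exp_add, Complex.exp_int_mul_two_pi_mul_I]
    simp

/-- Bessel's inequality for an absolutely convergent power series on a circle, with the radius
absorbed into the coefficients. -/
theorem sum_norm_sq_le_integral {β : ℕ → ℂ} {f : ℝ → ℂ} (hβ : Summable fun k => ‖β k‖)
    (hf : Continuous f)
    (hs : ∀ θ : ℝ, HasSum (fun k => β k * Complex.exp (k * θ * Complex.I)) (f θ))
    (s : Finset ℕ) :
    ∑ k ∈ s, ‖β k‖ ^ 2 ≤ (2 * Real.pi)⁻¹ * ∫ θ in (-Real.pi)..Real.pi, ‖f θ‖ ^ 2 := by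
  have hab : -Real.pi < Real.pi := by linarith [Real.pi_pos]
  have hL2 : MemLp f 2 (volume.restrict (Set.Ioc (-Real.pi) Real.pi)) := by
    rw [memLp_two_iff_integrable_sq_norm hf.aestronglyMeasurable]
    exact (hf.norm.pow 2).integrableOn_Ioc
  have hpar := hasSum_sq_fourierCoeffOn hab hL2
  have hcoef : ∀ k : ℕ, fourierCoeffOn hab f (k : ℤ) = β k := fun k => by
    rw [fourierCoeffOn_eq_integral]
    have hterm : ∀ θ : ℝ, (fourier (-(k : ℤ)) (θ : AddCircle (Real.pi - -Real.pi)) : ℂ) =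
        Complex.exp (-k * θ * Complex.I) := fun θ => by
      rw [fourier_coe_apply]
      congr 1
      have : (Real.pi : ℂ) ≠ 0 := by exact_mod_cast Real.pi_ne_zero
      push_cast
      field_simp
      ring
    have hsum := intervalIntegral.hasSum_integral_of_dominated_convergence
      (μ := volume) (a := -Real.pi) (b := Real.pi)
      (F := fun (j : ℕ) (θ : ℝ) => Complex.exp (-k * θ * Complex.I) *
        (β j * Complex.exp (j * θ * Complex.I)))
      (f := fun θ => Complex.exp (-k * θ * Complex.I) * f θ)
      (fun j _ => ‖β j‖)
      (fun j => by fun_prop)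
      (fun j => Eventually.of_forall fun θ _ => by
        have h1 := Complex.norm_exp_ofReal_mul_I (-k * θ)
        have h2 := Complex.norm_exp_ofReal_mul_I (j * θ)
        push_cast at h1 h2
        rw [norm_mul, norm_mul, h1, h2, one_mul, mul_one])
      (Eventually.of_forall fun θ _ => hβ)
      (by simp)
      (Eventually.of_forall fun θ _ => (hs θ).mul_left _)
    have hint : ∀ j : ℕ, ∫ θ in (-Real.pi)..Real.pi, Complex.exp (-k * θ * Complex.I) *
        (β j * Complex.exp (j * θ * Complex.I)) = if j = k then β k * (2 * Real.pi) else 0 := by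
      intro j
      have e : ∀ θ : ℝ, Complex.exp (-k * θ * Complex.I) * (β j * Complex.exp (j * θ * Complex.I)) =
          β j * Complex.exp ((((j : ℤ) - k : ℤ) : ℂ) * θ * Complex.I) := fun θ => by
        rw [mul_left_comm, ← Complex.exp_add]
        congr 2
        push_cast
        ring
      simp_rw [e]
      rw [intervalIntegral.integral_const_mul, integral_cexp_int_mul]
      by_cases hjk : j = k
      · subst hjk; simp
      · rw [if_neg hjk, if_neg (by omega), mul_zero]
    simp_rw [hint] at hsum
    have huniq := hsum.unique (hasSum_ite_eq k (β k * (2 * Real.pi : ℂ)))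
    simp_rw [hterm, smul_eq_mul]
    rw [huniq, show Real.pi - -Real.pi = 2 * Real.pi by ring]
    have : (Real.pi : ℂ) ≠ 0 := by exact_mod_cast Real.pi_ne_zero
    rw [Complex.real_smul]
    push_cast
    field_simp
  have hle := sum_le_hasSum (s.map Nat.castEmbedding) (fun i _ => by positivity) hpar
  rw [Finset.sum_map] at hle
  simp only [Nat.castEmbedding_apply, hcoef, smul_eq_mul] at hle
  rwa [show Real.pi - -Real.pi = 2 * Real.pi by ring] at hle

/-- Evaluating the generating function on a circle: the squares of the Hermite functions, weighted
by the Poisson distribution with mean `2 r²`, are bounded by a phase-space average. -/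
theorem sum_poisson_mul_hermitePsi_sq_le {r : ℝ} (x : ℝ) (s : Finset ℕ) :
    ∑ k ∈ s, Real.exp (-(2 * r ^ 2)) * (2 * r ^ 2) ^ k / k.factorial * hermitePsi k x ^ 2 ≤
      (√Real.pi)⁻¹ * ((2 * Real.pi)⁻¹ *
        ∫ θ in (-Real.pi)..Real.pi, Real.exp (-(x - 2 * r * Real.cos θ) ^ 2)) := by
  set A : ℝ := Real.exp (-x ^ 2 / 2) * Real.exp (-r ^ 2) with hA
  have hgen := hasSum_hermitePoly_generating x
  set β : ℕ → ℂ := fun k =>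
    A * ((((hermitePoly k).eval x : ℝ) : ℂ) / k.factorial * (r : ℂ) ^ k) with hβdef
  have hβ : Summable fun k => ‖β k‖ := ((hgen r).summable.mul_left _).norm
  set f : ℝ → ℂ := fun θ => A * Complex.exp (2 * x * (r * Complex.exp (θ * Complex.I)) -
    (r * Complex.exp (θ * Complex.I)) ^ 2) with hfdef
  have hs : ∀ θ : ℝ, HasSum (fun k => β k * Complex.exp (k * θ * Complex.I)) (f θ) := fun θ => by
    convert! (hgen (r * Complex.exp (θ * Complex.I))).mul_left (A : ℂ) using 1
    funext k
    rw [mul_pow, ← Complex.exp_nat_mul, hβdef]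
    simp only [mul_assoc]
  have key := sum_norm_sq_le_integral hβ (by fun_prop) hs s
  have hnf : ∀ θ : ℝ, ‖f θ‖ ^ 2 = Real.exp (-(x - 2 * r * Real.cos θ) ^ 2) := fun θ => by
    have hre : (2 * x * (r * Complex.exp (θ * Complex.I)) -
        (r * Complex.exp (θ * Complex.I)) ^ 2 : ℂ).re =
        2 * x * r * Real.cos θ - r ^ 2 * (2 * Real.cos θ ^ 2 - 1) := by
      have h1 : (2 * x * (r * Complex.exp (θ * Complex.I)) -
        (r * Complex.exp (θ * Complex.I)) ^ 2 : ℂ) =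
        ((2 * x * r * Real.cos θ - r ^ 2 * (Real.cos θ ^ 2 - Real.sin θ ^ 2) : ℝ) : ℂ) +
        ((2 * x * r * Real.sin θ - 2 * r ^ 2 * Real.cos θ * Real.sin θ : ℝ) : ℂ) * Complex.I := by
        rw [Complex.exp_mul_I]
        push_cast
        linear_combination (-(r : ℂ) ^ 2 * Complex.sin θ ^ 2) * Complex.I_sq
      rw [h1]
      simp only [Complex.add_re, Complex.ofReal_re, Complex.re_ofReal_mul, Complex.I_re, mul_zero,
        add_zero]
      rw [Real.sin_sq]
      ring
    rw [hfdef]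
    simp only
    rw [norm_mul, Complex.norm_exp, hre, Complex.norm_real, Real.norm_of_nonneg (by positivity), hA,
      ← Real.exp_add, ← Real.exp_add, ← Real.exp_nat_mul]
    congr 1
    push_cast
    ring
  simp_rw [hnf] at key
  have hβn : ∀ k, ‖β k‖ ^ 2 =
      √Real.pi * (Real.exp (-(2 * r ^ 2)) * (2 * r ^ 2) ^ k / k.factorial *
        hermitePsi k x ^ 2) := by
    intro k
    have hb : β k = ((A * ((hermitePoly k).eval x / k.factorial * r ^ k) : ℝ) : ℂ) := by
      rw [hβdef]; push_cast; rfl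
    have hpi : 0 < √Real.pi := Real.sqrt_pos.2 Real.pi_pos
    have hk : (0 : ℝ) < k.factorial := by exact_mod_cast k.factorial_pos
    have e1 : Real.exp (-(2 * r ^ 2)) = Real.exp (-r ^ 2) ^ 2 := by
      rw [← Real.exp_nat_mul]; congr 1; push_cast; ring
    rw [hb, Complex.norm_real, Real.norm_eq_abs, sq_abs, hermitePsi_eq, div_pow,
      Real.sq_sqrt (gammaNorm_pos k).le, gammaNorm, hA, e1]
    rw [mul_pow 2 (r ^ 2) k]
    field_simp
    ring
  simp_rw [hβn] at key
  rw [← Finset.mul_sum] at key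
  rwa [inv_mul_eq_div, le_div_iff₀' (Real.sqrt_pos.2 Real.pi_pos)]

theorem integral_phase_le_one (x A : ℝ) :
    (2 * Real.pi)⁻¹ * ∫ θ in (-Real.pi)..Real.pi, Real.exp (-(x - A * Real.cos θ) ^ 2) ≤ 1 := by
  have hpi := Real.pi_pos
  have h : ∫ θ in (-Real.pi)..Real.pi, Real.exp (-(x - A * Real.cos θ) ^ 2) ≤
      ∫ _ in (-Real.pi)..Real.pi, (1 : ℝ) := by
    refine intervalIntegral.integral_mono_on (by linarith)
      (Continuous.intervalIntegrable (by fun_prop) _ _) (by simp) fun θ _ => ?_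
    exact Real.exp_le_one_iff.2 (by nlinarith [sq_nonneg (x - A * Real.cos θ)])
  rw [intervalIntegral.integral_const, smul_eq_mul] at h
  rw [inv_mul_le_iff₀ (by positivity)]
  linarith

/-- The phase average tends to zero uniformly in `x`: near `θ = 0, π` the range of integration is
small, and elsewhere `x - A cos θ` is a coordinate with density of order `1 / A`. -/
theorem exists_integral_phase_le {δ : ℝ} (hδ : 0 < δ) :
    ∃ A₀ : ℝ, ∀ A ≥ A₀, ∀ x : ℝ,
      (2 * Real.pi)⁻¹ * ∫ θ in (-Real.pi)..Real.pi, Real.exp (-(x - A * Real.cos θ) ^ 2) ≤ δ := by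
  have hpi := Real.pi_pos
  set ε := min δ 1 with hε
  have hε0 : 0 < ε := lt_min hδ one_pos
  have hε1 : ε ≤ 1 := min_le_right _ _
  have hεδ : ε ≤ δ := min_le_left _ _
  have hπ3 := Real.pi_gt_three
  have hsin : 0 < Real.sin ε := Real.sin_pos_of_pos_of_lt_pi hε0 (by linarith)
  refine ⟨√Real.pi / (δ * Real.sin ε), fun A hA x => ?_⟩
  have hA0 : 0 < A := lt_of_lt_of_le (by positivity) hA
  set E : ℝ → ℝ := fun θ => Real.exp (-(x - A * Real.cos θ) ^ 2) with hE
  have hEc : Continuous E := by fun_prop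
  have hEi : ∀ a b : ℝ, IntervalIntegrable E volume a b := fun a b => hEc.intervalIntegrable _ _
  have hE1 : ∀ θ, E θ ≤ 1 := fun θ =>
    Real.exp_le_one_iff.2 (by nlinarith [sq_nonneg (x - A * Real.cos θ)])
  have hshort : ∀ a : ℝ, ∫ θ in a..(a + ε), E θ ≤ ε := fun a => by
    have h := intervalIntegral.integral_mono_on (a := a) (b := a + ε) (by linarith) (hEi _ _)
      (by simp : IntervalIntegrable (fun _ => (1 : ℝ)) volume a (a + ε)) fun θ _ => hE1 θ
    rw [intervalIntegral.integral_const, smul_eq_mul] at h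
    linarith
  -- the factor `sin θ / sin ε ≥ 1` allows the substitution `u = x - A cos θ`
  have hmid : ∫ θ in ε..(Real.pi - ε), E θ ≤ δ := by
    have h1 : ∫ θ in ε..(Real.pi - ε), E θ * (A * Real.sin ε) ≤
        ∫ θ in ε..(Real.pi - ε), Real.exp (-(x - A * Real.cos θ) ^ 2) * (A * Real.sin θ) := by
      refine intervalIntegral.integral_mono_on (by linarith) ((hEi _ _).mul_const _)
        (Continuous.intervalIntegrable (by fun_prop) _ _) fun θ hθ => ?_
      have hs : Real.sin ε ≤ Real.sin θ := by
        rcases le_total θ (Real.pi / 2) with h | h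
        · exact Real.sin_le_sin_of_le_of_le_pi_div_two (by linarith) h hθ.1
        · rw [← Real.sin_pi_sub θ]
          exact Real.sin_le_sin_of_le_of_le_pi_div_two (by linarith) (by linarith)
            (by linarith [hθ.2])
      gcongr
    have h2 : ∫ θ in ε..(Real.pi - ε), Real.exp (-(x - A * Real.cos θ) ^ 2) * (A * Real.sin θ) =
        ∫ u in (x - A * Real.cos ε)..(x - A * Real.cos (Real.pi - ε)), Real.exp (-u ^ 2) := by
      refine intervalIntegral.integral_comp_mul_deriv (f := fun θ => x - A * Real.cos θ)
        (f' := fun θ => A * Real.sin θ) (g := fun u => Real.exp (-u ^ 2)) (fun θ _ => ?_)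
        (by fun_prop) (by fun_prop)
      simpa using ((Real.hasDerivAt_cos θ).const_mul A).const_sub x
    have hle : x - A * Real.cos ε ≤ x - A * Real.cos (Real.pi - ε) := by
      rw [Real.cos_pi_sub]
      have : 0 < Real.cos ε := Real.cos_pos_of_mem_Ioo ⟨by linarith, by linarith⟩
      nlinarith
    have h3 : ∫ u in (x - A * Real.cos ε)..(x - A * Real.cos (Real.pi - ε)), Real.exp (-u ^ 2) ≤
        √Real.pi := by
      rw [intervalIntegral.integral_of_le hle, ← integral_weight]
      exact setIntegral_le_integral integrable_exp_neg_sq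
        (Eventually.of_forall fun u => (Real.exp_pos _).le)
    rw [intervalIntegral.integral_mul_const, h2] at h1
    have h4 : √Real.pi ≤ δ * (A * Real.sin ε) := by
      have := (div_le_iff₀ (by positivity)).1 hA
      linarith
    exact le_of_mul_le_mul_right (h1.trans (h3.trans h4)) (by positivity)
  have hhalf : ∫ θ in (0 : ℝ)..Real.pi, E θ ≤ 3 * δ := by
    rw [← intervalIntegral.integral_add_adjacent_intervals (hEi 0 ε) (hEi ε Real.pi),
      ← intervalIntegral.integral_add_adjacent_intervals (hEi ε (Real.pi - ε))
        (hEi (Real.pi - ε) Real.pi)]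
    have h1 := hshort 0
    have h2 := hshort (Real.pi - ε)
    rw [zero_add] at h1
    rw [sub_add_cancel] at h2
    linarith
  have heven : ∫ θ in (-Real.pi)..0, E θ = ∫ θ in (0 : ℝ)..Real.pi, E θ := by
    have := intervalIntegral.integral_comp_neg (a := 0) (b := Real.pi) E
    rw [neg_zero] at this
    rw [← this]
    simp [hE]
  rw [← intervalIntegral.integral_add_adjacent_intervals (hEi _ 0) (hEi 0 _), heven,
    inv_mul_le_iff₀ (by positivity)]
  nlinarith

theorem factorial_le_stirling {k : ℕ} (hk : 0 < k) :
    (k.factorial : ℝ) ≤ Real.exp 1 * √k * (k / Real.exp 1) ^ k := by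
  obtain ⟨j, rfl⟩ := Nat.exists_eq_succ_of_ne_zero hk.ne'
  have h := Stirling.stirlingSeq'_antitone (Nat.zero_le j)
  simp only [Function.comp, Nat.succ_eq_add_one, zero_add, Stirling.stirlingSeq_one] at h
  have hk' : (0 : ℝ) < (j + 1 : ℕ) := by exact_mod_cast hk
  rw [Stirling.stirlingSeq, div_le_div_iff₀ (by positivity) (by positivity),
    Real.sqrt_mul (by norm_num)] at h
  have h2 : 0 < √2 := by positivity
  rw [← mul_le_mul_iff_left₀ h2]
  calc _ ≤ _ := h
    _ = _ := by simp only [Nat.succ_eq_add_one]; ring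

/-- The Poisson distribution with mean `m²` has mass at least of order `1 / m` at every point of the
block `m² ≤ k ≤ m² + 2 m`. -/
theorem poisson_lower_bound {m k : ℕ} (hm : 1 ≤ m) (hk1 : m ^ 2 ≤ k) (hk2 : k ≤ m ^ 2 + 2 * m) :
    Real.exp (-5) / (2 * m) ≤ Real.exp (-(m : ℝ) ^ 2) * ((m : ℝ) ^ 2) ^ k / k.factorial := by
  have hmR : (1 : ℝ) ≤ m := by exact_mod_cast hm
  have hm2 : (0 : ℝ) < (m : ℝ) ^ 2 := by positivity
  have hk0 : 0 < k := lt_of_lt_of_le (by positivity) hk1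
  have hkR : (0 : ℝ) < k := by exact_mod_cast hk0
  have hk1R : (m : ℝ) ^ 2 ≤ k := by exact_mod_cast hk1
  have hk2R : (k : ℝ) ≤ m ^ 2 + 2 * m := by exact_mod_cast hk2
  have hsqrt : √(k : ℝ) ≤ 2 * m := by
    rw [Real.sqrt_le_left (by positivity)]
    nlinarith
  have hfac := factorial_le_stirling hk0
  have hlog : Real.log (k / m ^ 2) ≤ k / m ^ 2 - 1 := Real.log_le_sub_one_of_pos (by positivity)
  -- `k - m² - k log (k / m²) ≥ - (k - m²)² / m² ≥ -4`
  have hpow : (k / m ^ 2 : ℝ) ^ k ≤ Real.exp (k - m ^ 2 + 4) := by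
    rw [← Real.exp_log (show (0 : ℝ) < k / m ^ 2 by positivity), ← Real.exp_nat_mul]
    refine Real.exp_le_exp.2 ((mul_le_mul_of_nonneg_left hlog hkR.le).trans ?_)
    have e : (k : ℝ) * (k / m ^ 2 - 1) = (k - m ^ 2) + (k - m ^ 2) ^ 2 / m ^ 2 := by
      field_simp
      ring
    have h4 : ((k : ℝ) - m ^ 2) ^ 2 / m ^ 2 ≤ 4 := by
      rw [div_le_iff₀ hm2]
      nlinarith
    linarith
  rw [div_le_div_iff₀ (by positivity) (by positivity)]
  have hmk : (0 : ℝ) < ((m : ℝ) ^ 2) ^ k := by positivity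
  have h5 : (k / Real.exp 1 : ℝ) ^ k ≤ Real.exp (4 - m ^ 2) * ((m : ℝ) ^ 2) ^ k := by
    have e1 : (k / Real.exp 1 : ℝ) ^ k = (k / m ^ 2 : ℝ) ^ k * ((m : ℝ) ^ 2) ^ k *
        Real.exp (-k) := by
      rw [← mul_pow, div_mul_cancel₀ _ hm2.ne', div_pow, ← Real.exp_nat_mul, mul_one, Real.exp_neg,
        div_eq_mul_inv]
    rw [e1]
    calc _ ≤ Real.exp (k - m ^ 2 + 4) * ((m : ℝ) ^ 2) ^ k * Real.exp (-k) := by gcongr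
      _ = _ := by
        rw [mul_right_comm, ← Real.exp_add]
        congr 2
        ring
  calc Real.exp (-5) * k.factorial ≤
        Real.exp (-5) * (Real.exp 1 * (2 * m) * (Real.exp (4 - m ^ 2) * ((m : ℝ) ^ 2) ^ k)) := by
        gcongr
        exact hfac.trans (by gcongr)
    _ = Real.exp (-5 + 1 + (4 - m ^ 2)) * ((m : ℝ) ^ 2) ^ k * (2 * m) := by
        rw [Real.exp_add, Real.exp_add]
        ring
    _ = _ := by
        congr 3
        ring

/-- The circle of radius `m / √2` is chosen so that the Poisson weights have mean `m ^ 2`, the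
beginning of the block. -/
theorem sum_block_hermitePsi_sq_le {m : ℕ} (hm : 1 ≤ m) (x : ℝ) :
    ∑ k ∈ Finset.Icc (m ^ 2) (m ^ 2 + 2 * m), hermitePsi k x ^ 2 ≤
      2 * Real.exp 5 * ((2 * Real.pi)⁻¹ *
        ∫ θ in (-Real.pi)..Real.pi, Real.exp (-(x - √2 * m * Real.cos θ) ^ 2)) * m := by
  have hmR : (0 : ℝ) < m := by exact_mod_cast hm
  have h2 : √2 * √2 = (2 : ℝ) := Real.mul_self_sqrt (by norm_num)
  have h20 : 0 < √2 := by positivity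
  have key := sum_poisson_mul_hermitePsi_sq_le (r := m / √2) x
    (Finset.Icc (m ^ 2) (m ^ 2 + 2 * m))
  have e1 : 2 * (m / √2 : ℝ) ^ 2 = (m : ℝ) ^ 2 := by
    rw [div_pow, Real.sq_sqrt (by norm_num)]; field_simp
  have e2 : 2 * (m / √2 : ℝ) = √2 * m := by
    field_simp
    linear_combination (-(1 : ℝ)) * h2
  rw [e1, e2] at key
  set J := (2 * Real.pi)⁻¹ *
    ∫ θ in (-Real.pi)..Real.pi, Real.exp (-(x - √2 * m * Real.cos θ) ^ 2) with hJ
  have hJ0 : 0 ≤ J := by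
    have hpi := Real.pi_pos
    refine mul_nonneg (by positivity) (intervalIntegral.integral_nonneg (by linarith) fun θ _ => ?_)
    positivity
  have hlow : Real.exp (-5) / (2 * m) *
      ∑ k ∈ Finset.Icc (m ^ 2) (m ^ 2 + 2 * m), hermitePsi k x ^ 2 ≤ (√Real.pi)⁻¹ * J := by
    rw [Finset.mul_sum]
    refine le_trans (Finset.sum_le_sum fun k hk => ?_) key
    rw [Finset.mem_Icc] at hk
    exact mul_le_mul_of_nonneg_right (poisson_lower_bound hm hk.1 hk.2) (sq_nonneg _)
  have hpi : (√Real.pi)⁻¹ ≤ 1 := by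
    refine inv_le_one_of_one_le₀ ?_
    rw [Real.one_le_sqrt]
    linarith [Real.pi_gt_three]
  have h3 : (√Real.pi)⁻¹ * J ≤ J := mul_le_of_le_one_left hJ0 hpi
  have h4 := hlow.trans h3
  rw [div_mul_eq_mul_div, div_le_iff₀ (by positivity)] at h4
  have h5 : Real.exp 5 * Real.exp (-5) = 1 := by rw [← Real.exp_add]; simp
  have h6 := mul_le_mul_of_nonneg_left h4 (Real.exp_pos 5).le
  rw [← mul_assoc, h5, one_mul] at h6
  linarith

/-- On the block `m² ≤ k ≤ m² + 2 m` the squares `ψ_k(x) ^ 2` add up to `o(m)`, uniformly in `x`. -/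
theorem exists_sum_block_le {δ : ℝ} (hδ : 0 < δ) :
    ∃ m₀ : ℕ, ∀ m ≥ m₀, ∀ x : ℝ,
      ∑ k ∈ Finset.Icc (m ^ 2) (m ^ 2 + 2 * m), hermitePsi k x ^ 2 ≤ δ * m := by
  obtain ⟨A₀, hA₀⟩ := exists_integral_phase_le (δ := δ / (2 * Real.exp 5)) (by positivity)
  obtain ⟨m₁, hm₁⟩ := exists_nat_ge A₀
  refine ⟨max m₁ 1, fun m hm x => ?_⟩
  have hm1 : 1 ≤ m := (le_max_right _ _).trans hm
  refine (sum_block_hermitePsi_sq_le hm1 x).trans ?_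
  have hA : A₀ ≤ √2 * m := by
    have h1 : (m₁ : ℝ) ≤ m := by exact_mod_cast (le_max_left _ _).trans hm
    have h2 : (1 : ℝ) ≤ √2 := by rw [Real.one_le_sqrt]; norm_num
    nlinarith [(Nat.cast_nonneg m : (0 : ℝ) ≤ m)]
  have := hA₀ _ hA x
  rw [le_div_iff₀ (by positivity)] at this
  gcongr
  linarith

/-! ### The uniform norm of the tails -/

/-- Since the block sums are `o(m)`, the uniform error is `o(n ^ (1 / 4) exp (-ρ √(2 n)))`. Hence
the ratio of the two can be bounded by a sequence with any prescribed limit `L ≥ 0`. -/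
theorem exists_linfty_bound {g : ℝ → ℂ} (hg : MemLp g 2 volume) {ρ D L : ℝ} (hρ : 0 < ρ)
    (hD : 0 ≤ D) (hc : ∀ k, ‖hermiteCoeff g k‖ ≤ D * coeffRate ρ k) (hL : 0 ≤ L) :
    ∃ K : ℕ → ℝ, Tendsto K atTop (𝓝 L) ∧ ∀ n : ℕ, 1 ≤ n →
      eLpNorm (fun x : ℝ => g x - hermiteProj n (hg.toLp g) x) ⊤ volume ≤
        ENNReal.ofReal (K n * (n : ℝ) ^ (1 / 4 : ℝ) * Real.exp (-ρ * √(2 * (n : ℝ)))) := by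
  set Q := D / √(√2 * ρ) * Real.exp (√2 * ρ) *
    (∑' j : ℕ, (1 + (j : ℝ)) * Real.exp (-(√2 * ρ) * j)) with hQ
  have hQ0 : 0 ≤ Q :=
    mul_nonneg (by positivity) (tsum_nonneg fun j => by positivity)
  set w : ℕ → ℝ := fun n => (n : ℝ) ^ (1 / 4 : ℝ) * Real.exp (-ρ * √(2 * (n : ℝ))) with hw
  have hw0 : ∀ n, 1 ≤ n → 0 < w n := fun n hn => by
    have : (0 : ℝ) < n := by exact_mod_cast hn
    positivity
  have hsup : ∀ δ : ℝ, 0 ≤ δ → ∀ n : ℕ, 1 ≤ n → (∀ m : ℕ, Nat.sqrt n ≤ m → ∀ x : ℝ,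
      ∑ k ∈ Finset.Icc (m ^ 2) (m ^ 2 + 2 * m), hermitePsi k x ^ 2 ≤ δ * m) →
      eLpNorm (fun x : ℝ => g x - hermiteProj n (hg.toLp g) x) ⊤ volume ≤
        ENNReal.ofReal (Q * √δ * w n) := fun δ hδ n hn hblock => by
    rw [eLpNorm_exponent_top]
    exact eLpNormEssSup_le_of_ae_bound (norm_sub_hermiteProj_apply_le hg
      (sum_coeff_mul_psi_le hρ hD hc hδ hn hblock))
  have hfin : ∀ n : ℕ, 1 ≤ n →
      eLpNorm (fun x : ℝ => g x - hermiteProj n (hg.toLp g) x) ⊤ volume ≠ ⊤ := fun n hn => by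
    refine ne_top_of_le_ne_top ENNReal.ofReal_ne_top
      (hsup (2 * Real.exp 5) (by positivity) n hn fun m hm x => ?_)
    have hm1 : 1 ≤ m := (Nat.le_sqrt.2 (by simpa using hn)).trans hm
    refine (sum_block_hermitePsi_sq_le hm1 x).trans ?_
    have := integral_phase_le_one x (√2 * m)
    exact mul_le_mul_of_nonneg_right (mul_le_of_le_one_right (by positivity) this)
      (Nat.cast_nonneg m)
  obtain ⟨K, hK, hle⟩ := exists_tendsto_of_eventually_le (L := L) (r := fun n : ℕ =>
    (eLpNorm (fun x : ℝ => g x - hermiteProj n (hg.toLp g) x) ⊤ volume).toReal / w n) (by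
      intro δ hδ
      set δ' := (δ / (Q + 1)) ^ 2 with hδ'
      obtain ⟨m₀, hm₀⟩ := exists_sum_block_le (δ := δ') (by positivity)
      filter_upwards [eventually_ge_atTop 1, eventually_ge_atTop (m₀ ^ 2)] with n hn1 hn2
      have h1 := hsup δ' (by positivity) n hn1 fun m hm x =>
        hm₀ m ((Nat.le_sqrt'.2 hn2).trans hm) x
      have hwn := hw0 n hn1
      have h2 := ENNReal.toReal_le_of_le_ofReal (by positivity) h1
      have h3 : Q * √δ' ≤ δ := by
        rw [hδ', Real.sqrt_sq (by positivity), mul_div_assoc', div_le_iff₀ (by positivity)]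
        nlinarith
      rw [div_le_iff₀ hwn]
      refine h2.trans (mul_le_mul_of_nonneg_right ?_ hwn.le)
      linarith)
  refine ⟨K, hK, fun n hn => ?_⟩
  have h1 := (div_le_iff₀ (hw0 n hn)).1 (hle n)
  rw [← ENNReal.ofReal_toReal (hfin n hn), mul_assoc]
  exact ENNReal.ofReal_le_ofReal h1

/-! ### Functions of Gaussian decay in the strip -/

/-- The growth condition controls `F` outside a disc, and continuity inside; the power `‖z‖ ^ σ` is
replaced by a power of `1 + x ^ 2`. -/
theorem exists_poly_bound {F : ℂ → ℂ} {ρ σ M : ℝ} (hρ : 0 < ρ) (hF : ContinuousOn F (strip ρ))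
    (hgrowth : ∀ᶠ z : ℂ in Bornology.cobounded ℂ ⊓ Filter.principal (strip ρ),
      ‖F z‖ ≤ M * ‖z‖ ^ σ) :
    ∃ (C : ℝ) (p : ℕ), ∀ x y : ℝ, |y| ≤ ρ → ‖F (x + y * Complex.I)‖ ≤ C * (1 + x ^ 2) ^ p := by
  rw [eventually_inf_principal, hasBasis_cobounded_norm.eventually_iff] at hgrowth
  obtain ⟨r₀, -, hr₀⟩ := hgrowth
  set r := max r₀ 1 with hr
  have hclosed : IsClosed (strip ρ) :=
    isClosed_Icc.preimage Complex.continuous_im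
  have hcomp : IsCompact (Metric.closedBall (0 : ℂ) r ∩ strip ρ) :=
    (isCompact_closedBall 0 r).inter_right hclosed
  obtain ⟨C₁, hC₁⟩ := hcomp.exists_bound_of_continuousOn (hF.mono Set.inter_subset_right)
  set p := ⌈|σ|⌉₊ with hp
  refine ⟨|C₁| + |M| * (1 + ρ) ^ p, p, fun x y hy => ?_⟩
  have hz : (x + y * Complex.I : ℂ) ∈ strip ρ := by simpa [strip] using abs_le.1 hy
  have h1 : 1 ≤ (1 + x ^ 2) ^ p := one_le_pow₀ (by nlinarith [sq_nonneg x])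
  rcases le_total ‖(x + y * Complex.I : ℂ)‖ r with hle | hge
  · calc _ ≤ C₁ := hC₁ _ ⟨by simpa using hle, hz⟩
      _ ≤ |C₁| * 1 := by rw [mul_one]; exact le_abs_self _
      _ ≤ _ := by
          refine mul_le_mul ?_ h1 zero_le_one (by positivity)
          have : 0 ≤ |M| * (1 + ρ) ^ p := by positivity
          linarith
  · have hz1 : 1 ≤ ‖(x + y * Complex.I : ℂ)‖ := (le_max_right _ _).trans hge
    have hnorm : ‖(x + y * Complex.I : ℂ)‖ ≤ (1 + ρ) * (1 + x ^ 2) := by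
      have h2 := Complex.norm_le_abs_re_add_abs_im (x + y * Complex.I : ℂ)
      simp only [Complex.add_re, Complex.ofReal_re, Complex.mul_re, Complex.I_re, mul_zero,
        Complex.ofReal_im, Complex.I_im, mul_one, sub_self, add_zero, Complex.add_im,
        Complex.mul_im, zero_add] at h2
      have h3 : |x| ≤ 1 + x ^ 2 := by nlinarith [sq_nonneg (|x| - 1), sq_abs x, abs_nonneg x]
      nlinarith [sq_nonneg x]
    calc _ ≤ M * ‖(x + y * Complex.I : ℂ)‖ ^ σ := hr₀ ((le_max_left _ _).trans hge) hz
      _ ≤ |M| * ‖(x + y * Complex.I : ℂ)‖ ^ (p : ℝ) := by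
          gcongr
          · exact le_abs_self M
          · exact (le_abs_self σ).trans (Nat.le_ceil _)
      _ ≤ |M| * ((1 + ρ) * (1 + x ^ 2)) ^ p := by
          rw [Real.rpow_natCast]
          gcongr
      _ ≤ _ := by
          rw [mul_pow, ← mul_assoc]
          gcongr
          linarith [abs_nonneg C₁]

theorem integrable_one_add_sq_pow_mul_exp_half (q : ℕ) :
    Integrable fun x : ℝ => (1 + x ^ 2) ^ q * Real.exp (-x ^ 2 / 2) := by
  have h2 : √2 ≠ 0 := by positivity
  refine (((integrable_one_add_sq_pow_mul_exp q).comp_div h2).const_mul (2 ^ q)).mono'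
    (by fun_prop) (Eventually.of_forall fun x => ?_)
  rw [Real.norm_of_nonneg (by positivity), ← mul_assoc, ← mul_pow, div_pow,
    Real.sq_sqrt (by norm_num), neg_div]
  gcongr
  nlinarith [sq_nonneg x]

section Gaussian

variable {f : ℂ → ℂ} {ρ C : ℝ} {p : ℕ}

/-- The norm of `f` on a horizontal line in terms of `F(z) = exp (z ^ 2 / 2) f(z)`. -/
theorem norm_line_eq (f : ℂ → ℂ) (x b : ℝ) :
    ‖f (x + b * Complex.I)‖ = Real.exp (b ^ 2 / 2) *
      (‖Complex.exp ((x + b * Complex.I) ^ 2 / 2) * f (x + b * Complex.I)‖ *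
        Real.exp (-x ^ 2 / 2)) := by
  have e : ((x + b * Complex.I : ℂ) ^ 2 / 2).re = x ^ 2 / 2 - b ^ 2 / 2 := by
    have h1 : ((x + b * Complex.I : ℂ) ^ 2 / 2) =
        ((x ^ 2 / 2 - b ^ 2 / 2 : ℝ) : ℂ) + ((x * b : ℝ) : ℂ) * Complex.I := by
      push_cast
      linear_combination ((b : ℂ) ^ 2 / 2) * Complex.I_sq
    rw [h1]
    simp only [Complex.add_re, Complex.ofReal_re, Complex.re_ofReal_mul, Complex.I_re, mul_zero,
      add_zero]
  have h2 : Real.exp (b ^ 2 / 2) *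
      (Real.exp (x ^ 2 / 2 - b ^ 2 / 2) * Real.exp (-x ^ 2 / 2)) = 1 := by
    rw [← Real.exp_add, ← Real.exp_add, Real.exp_eq_one_iff]
    ring
  rw [norm_mul, Complex.norm_exp, e]
  linear_combination (-‖f (x + b * Complex.I)‖) * h2

theorem integrable_line (hf : DifferentiableOn ℂ f (strip ρ))
    (hb : ∀ x y : ℝ, |y| ≤ ρ → ‖Complex.exp ((x + y * Complex.I) ^ 2 / 2) *
      f (x + y * Complex.I)‖ ≤ C * (1 + x ^ 2) ^ p) {b : ℝ} (hbρ : |b| ≤ ρ) :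
    Integrable fun x : ℝ => f (x + b * Complex.I) := by
  refine ((integrable_one_add_sq_pow_mul_exp_half p).const_mul
    (Real.exp (b ^ 2 / 2) * C)).mono' (continuous_line hf hbρ).aestronglyMeasurable
    (Eventually.of_forall fun x => ?_)
  rw [norm_line_eq, mul_assoc, ← mul_assoc C]
  gcongr
  exact hb x b hbρ

theorem memLp_real_line (hρ : 0 < ρ) (hf : DifferentiableOn ℂ f (strip ρ))
    (hb : ∀ x y : ℝ, |y| ≤ ρ → ‖Complex.exp ((x + y * Complex.I) ^ 2 / 2) *
      f (x + y * Complex.I)‖ ≤ C * (1 + x ^ 2) ^ p) :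
    MemLp (fun x : ℝ => f x) 2 volume := by
  have hc : Continuous fun x : ℝ => f x := by
    simpa using continuous_line hf (y := 0) (by simpa using hρ.le)
  rw [memLp_two_iff_integrable_sq_norm hc.aestronglyMeasurable]
  refine ((integrable_one_add_sq_pow_mul_exp (2 * p)).const_mul (C ^ 2)).mono'
    (hc.norm.pow 2).aestronglyMeasurable (Eventually.of_forall fun x => ?_)
  have h1 := norm_line_eq f x 0
  have h2 := hb x 0 (by simpa using hρ.le)
  simp only [Complex.ofReal_zero, zero_mul, add_zero, ne_eq, OfNat.ofNat_ne_zero,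
    not_false_eq_true, zero_pow, zero_div, Real.exp_zero, one_mul] at h1 h2
  rw [Real.norm_of_nonneg (by positivity), h1]
  have e : C ^ 2 * ((1 + x ^ 2) ^ (2 * p) * Real.exp (-x ^ 2)) =
      (C * (1 + x ^ 2) ^ p * Real.exp (-x ^ 2 / 2)) ^ 2 := by
    rw [mul_pow, mul_pow, ← Real.exp_nat_mul, ← pow_mul, mul_comm p 2]
    push_cast
    rw [mul_div_cancel₀ _ (two_ne_zero), mul_assoc]
  rw [e]
  gcongr

end Gaussian

/-- Passing from the constant for the coefficients to the constant for the `L²` error. -/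
theorem coeff_limit_div_sqrt (V ρ : ℝ) :
    V / ((2 : ℝ) ^ (3 / 4 : ℝ) * √Real.pi) / √(√2 * ρ) = V / √(4 * Real.pi * ρ) := by
  have h1 : ((2 : ℝ) ^ (3 / 4 : ℝ)) = √(2 * √2) := by
    rw [Real.sqrt_eq_rpow, Real.sqrt_eq_rpow]
    nth_rw 2 [← Real.rpow_one 2]
    rw [← Real.rpow_add (by norm_num), ← Real.rpow_mul (by norm_num)]
    norm_num
  have h3 : √2 * √2 = (2 : ℝ) := Real.mul_self_sqrt (by norm_num)
  have hpi := Real.pi_pos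
  rw [div_div, h1, ← Real.sqrt_mul (by positivity), ← Real.sqrt_mul (by positivity)]
  congr 2
  linear_combination (2 * Real.pi * ρ) * h3

end HermiteApprox

end

/-! ### Root-exponential convergence of Hermite approximation -/

theorem mainTheorem3 (f : ℂ → ℂ) (ρ σ M : ℝ) (hρ : 0 < ρ)
    (hf : AnalyticOnNhd ℂ f (HermiteApprox.strip ρ))
    (hgrowth : ∀ᶠ z : ℂ in Bornology.cobounded ℂ ⊓ Filter.principal (HermiteApprox.strip ρ),
      ‖Complex.exp (z ^ 2 / 2) * f z‖ ≤ M * ‖z‖ ^ σ) :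
    -- `V̂` is a convergent integral and `f` is square integrable on the real line
    Integrable (fun x : ℝ => f (x + ρ * Complex.I)) ∧
    Integrable (fun x : ℝ => f (x - ρ * Complex.I)) ∧
    ∃ hL2 : MemLp (fun x : ℝ => f x) 2 volume,
      -- the projection is the partial sum of the expansion in Hermite functions
      (∀ n : ℕ, (HermiteApprox.hermiteProj n (hL2.toLp _) : ℝ → ℂ) =ᵐ[volume]
        fun x => ∑ k ∈ Finset.range (n + 1),
          HermiteApprox.hermiteCoeff (fun x => f x) k * (HermiteApprox.hermitePsi k x : ℂ)) ∧
      -- (i)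
      (∃ K : ℕ → ℝ,
        Filter.Tendsto K Filter.atTop
          (nhds (HermiteApprox.boundaryIntegral f ρ /
            ((2 : ℝ) ^ (3 / 4 : ℝ) * Real.sqrt Real.pi))) ∧
        ∀ n : ℕ, max ⌊σ⌋ 0 ≤ (n : ℤ) →
          ‖HermiteApprox.hermiteCoeff (fun x => f x) n‖ ≤
            K n * (Real.exp (-ρ * Real.sqrt (2 * ((n : ℝ) + 1))) /
              ((n : ℝ) + 1) ^ (1 / 4 : ℝ))) ∧
      -- (ii)
      (∃ K : ℕ → ℝ,
        Filter.Tendsto K Filter.atTop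
          (nhds (HermiteApprox.boundaryIntegral f ρ / Real.sqrt (4 * Real.pi * ρ))) ∧
        ∀ n : ℕ,
          eLpNorm (fun x : ℝ => f x - HermiteApprox.hermiteProj n (hL2.toLp _) x) 2 volume ≤
            ENNReal.ofReal (K n * Real.exp (-ρ * Real.sqrt (2 * (n : ℝ))))) ∧
      -- (iii)
      (∃ K : ℕ → ℝ,
        Filter.Tendsto K Filter.atTop
          (nhds (HermiteApprox.boundaryIntegral f ρ /
            ((2 : ℝ) ^ (1 / 4 : ℝ) * Real.pi ^ (3 / 4 : ℝ) * ρ))) ∧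
        ∀ n : ℕ, 1 ≤ n →
          eLpNorm (fun x : ℝ => f x - HermiteApprox.hermiteProj n (hL2.toLp _) x) ⊤ volume ≤
            ENNReal.ofReal
              (K n * (n : ℝ) ^ (1 / 4 : ℝ) * Real.exp (-ρ * Real.sqrt (2 * (n : ℝ))))) := by
  -- the function with polynomial growth is `F(z) = exp (z ^ 2 / 2) f(z)`
  have hfd : DifferentiableOn ℂ f (HermiteApprox.strip ρ) := hf.differentiableOn
  have hexpd : Differentiable ℂ fun z : ℂ => Complex.exp (z ^ 2 / 2) := by fun_prop
  have hFd : DifferentiableOn ℂ (fun z => Complex.exp (z ^ 2 / 2) * f z) (HermiteApprox.strip ρ) :=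
    hexpd.differentiableOn.mul hfd
  obtain ⟨C, p, hb⟩ := HermiteApprox.exists_poly_bound hρ hFd.continuousOn hgrowth
  have hρabs : |ρ| ≤ ρ := (abs_of_pos hρ).le
  have hρabs' : |(-ρ)| ≤ ρ := by rw [abs_neg, abs_of_pos hρ]
  have hneg : ∀ x : ℝ, (x - ρ * Complex.I : ℂ) = x + (-ρ : ℝ) * Complex.I := fun x => by
    push_cast; ring
  have hL2 := HermiteApprox.memLp_real_line hρ hfd hb
  set V := HermiteApprox.boundaryIntegral f ρ with hV
  have hV0 : 0 ≤ V := add_nonneg (integral_nonneg fun x => norm_nonneg _)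
    (integral_nonneg fun x => norm_nonneg _)
  set κ := V / ((2 : ℝ) ^ (3 / 4 : ℝ) * √Real.pi) with hκ
  have hκ0 : 0 ≤ κ := by positivity
  obtain ⟨K₀, hK₀, hle₀⟩ := HermiteApprox.exists_coeff_bound hρ hFd hb (g := fun x => f x)
    (fun x => by
      rw [← mul_assoc, Complex.ofReal_exp, ← Complex.exp_add]
      have : ((-x ^ 2 / 2 : ℝ) : ℂ) + (x : ℂ) ^ 2 / 2 = 0 := by push_cast; ring
      rw [this, Complex.exp_zero, one_mul])
  -- on the two boundary lines `exp (ρ ^ 2 / 2) ‖F‖ exp (-x ^ 2 / 2)` is `‖f‖`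
  have hlim : Real.exp (ρ ^ 2 / 2) *
      ((∫ x : ℝ, ‖Complex.exp ((x + ρ * Complex.I) ^ 2 / 2) * f (x + ρ * Complex.I)‖ *
          Real.exp (-x ^ 2 / 2)) +
        ∫ x : ℝ, ‖Complex.exp ((x + (-ρ : ℝ) * Complex.I) ^ 2 / 2) *
          f (x + (-ρ : ℝ) * Complex.I)‖ * Real.exp (-x ^ 2 / 2)) = V := by
    rw [hV, HermiteApprox.boundaryIntegral, mul_add, ← integral_const_mul, ← integral_const_mul]
    simp_rw [hneg, HermiteApprox.norm_line_eq f _ ρ, HermiteApprox.norm_line_eq f _ (-ρ), neg_sq]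
  rw [hlim] at hK₀
  have hcoeff : ∀ δ > 0, ∀ᶠ n in Filter.atTop,
      ‖HermiteApprox.hermiteCoeff (fun x => f x) n‖ ≤ (κ + δ) * HermiteApprox.coeffRate ρ n := by
    intro δ hδ
    filter_upwards [hle₀, hK₀.eventually_le_const (show κ < κ + δ by linarith)] with n h1 h2
    exact h1.trans (mul_le_mul_of_nonneg_right h2 (HermiteApprox.coeffRate_pos ρ n).le)
  obtain ⟨K₁, hK₁, hle₁⟩ := HermiteApprox.exists_tendsto_of_eventually_le (L := κ)
    (r := fun n => ‖HermiteApprox.hermiteCoeff (fun x => f x) n‖ / HermiteApprox.coeffRate ρ n)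
    (fun δ hδ => (hcoeff δ hδ).mono fun n hn =>
      (div_le_iff₀ (HermiteApprox.coeffRate_pos ρ n)).2 hn)
  have hle₁' : ∀ n, ‖HermiteApprox.hermiteCoeff (fun x => f x) n‖ ≤
      K₁ n * HermiteApprox.coeffRate ρ n := fun n =>
    (div_le_iff₀ (HermiteApprox.coeffRate_pos ρ n)).1 (hle₁ n)
  -- a bound for all `n` at once, as the uniform norm requires
  obtain ⟨D, hD⟩ := hK₁.bddAbove_range
  have hD' : ∀ n, ‖HermiteApprox.hermiteCoeff (fun x => f x) n‖ ≤
      |D| * HermiteApprox.coeffRate ρ n := fun n =>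
    (hle₁' n).trans (mul_le_mul_of_nonneg_right ((hD ⟨n, rfl⟩).trans (le_abs_self D))
      (HermiteApprox.coeffRate_pos ρ n).le)
  obtain ⟨K₂, hK₂, hle₂⟩ := HermiteApprox.exists_l2_bound hL2 hρ hκ0 hcoeff
  rw [hκ, HermiteApprox.coeff_limit_div_sqrt] at hK₂
  refine ⟨HermiteApprox.integrable_line hfd hb hρabs, ?_, hL2, fun n => ?_,
    ⟨K₁, hK₁, fun n _ => hle₁' n⟩, ⟨K₂, hK₂, fun n => ?_⟩,
    HermiteApprox.exists_linfty_bound hL2 hρ (abs_nonneg D) hD' (by positivity)⟩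
  · simp_rw [hneg]
    exact HermiteApprox.integrable_line hfd hb hρabs'
  · rw [HermiteApprox.hermiteProj_toLp]
    exact HermiteApprox.sum_smul_psiLp_ae _ _
  · rw [HermiteApprox.eLpNorm_sub_hermiteProj]
    exact ENNReal.ofReal_le_ofReal (hle₂ n)
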